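/- Let $\Omega\subset\mathbb R^2$ be a nonempty bounded open set and $\lambda,\nu>0$. Let $f:[0,1]\times\Omega\to\mathbb R$ be continuous and bounded below by an integrable function of $x$, i.e. $f(\gamma,x)\ge g(x)$ for some $g\in L^1(\Omega)$ (this is automatic if $f$ is continuous on $[0,1]\times\overline\Omega$). Let $\mu^0$ be a Borel probability measure on $[0,1]$, and let $c:[0,1]\times[0,1]\to\mathbb R$ be lower semicontinuous with $c(\gamma_1,\gamma_2)\ge a(\gamma_1)+b(\gamma_2)$ for all $\gamma_1,\gamma_2\in[0,1]$, where $a,b\in L^1([0,1])$ are upper semicontinuous. For $u:\Omega\to\mathbb R$ let $\mathrm{TV}(u)=\sup\{\int_\Omega u\,\mathrm{div}\,\xi\,dx:\ \xi\in C^1_c(\Omega,\mathbb R^2),\ \|\xi\|_\infty\le1\}$. Let $C'$ be the set of measurable functions $\phi:\Omega\times\mathbb R\to\{0,1\}$ (up to null sets) that have finite total variation in $\Omega\times\mathbb R$, satisfy $\phi=1$ a.e. on $\Omega\times(-\infty,0]$ and $\phi=0$ a.e. on $\Omega\times[1,\infty)$, and are nonincreasing in $\gamma$, i.e. $D_\gamma\phi\le0$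 in the sense of distributions. For $\phi\in C'$, $-D_\gamma\phi$ is a finite positive measure on $\Omega\times\mathbb R$; put $\mu^\phi(A)=\frac1{|\Omega|}(-D_\gamma\phi)(\Omega\times A)$ for Borel $A\subset[0,1]$. Let $D$ be the set of pairs $(\psi,\psi')$ of Borel functions $[0,1]\to\mathbb R$, integrable on $[0,1]$ with respect to Lebesgue measure, such that $\psi(\gamma_1)-\psi'(\gamma_2)\le c(\gamma_1,\gamma_2)$ for all $\gamma_1,\gamma_2\in[0,1]$. For $\phi\in C'$ and $(\psi,\psi')\in D$ let $$E'(\phi,\psi,\psi')=-\int_{\Omega\times[0,1]}f(\gamma,x)\,dD_\gamma\phi(x,\gamma)+\lambda\int_0^1\mathrm{TV}(\phi(\cdot,\gamma))\,d\gamma+\nu\Big(\int_0^1\psi\,d\mu^\phi-\int_0^1\psi'\,d\mu^0\Big)\in[-\infty,\infty],$$ where the integrals are taken in the extended sense $\int h^+-\int h^-$ and the last bracket is set to $-\infty$ (so that the pair does not contribute to the supremum below) whenever an expression $\infty-\infty$ occurs in it. Then there exists $\overline\phi\in C'$ with $$\sup_{(\psi,\psi')\in D}E'(\overline\phi,\psi,\psi')=\min_{\phi\in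 C'}\ \sup_{(\psi,\psi')\in D}E'(\phi,\psi,\psi').$$ -/

import Mathlib

open MeasureTheory Set

namespace LiftedWasserstein

/-- The plane, with its Euclidean norm. -/
abbrev Plane : Type := EuclideanSpace ℝ (Fin 2)

/-- `C¹` maps whose support is a compact subset of `U`. -/
structure IsTest {E F : Type*} [NormedAddCommGroup E] [NormedSpace ℝ E]
    [NormedAddCommGroup F] [NormedSpace ℝ F] (U : Set E) (w : E → F) : Prop where
  contDiff : ContDiff ℝ 1 w
  hasCompactSupport : HasCompactSupport w
  tsupport_subset : tsupport w ⊆ U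

/-- The divergence of a planar vector field. -/
noncomputable def div (ξ : Plane → Plane) (x : Plane) : ℝ :=
  ∑ i : Fin 2, (fderiv ℝ ξ x (EuclideanSpace.single i 1)) i

/-- The total variation of `u` in `Ω`:
`sup { ∫_Ω u div ξ : ξ ∈ C¹_c(Ω, ℝ²), ‖ξ‖_∞ ≤ 1 }`. The set of values is symmetric,
so cutting off the negative ones does not change the supremum. -/
noncomputable def TV (Ω : Set Plane) (u : Plane → ℝ) : ENNReal :=
  ⨆ (ξ : Plane → Plane) (_ : IsTest Ω ξ) (_ : ∀ x, ‖ξ x‖ ≤ 1),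
    ENNReal.ofReal (∫ x in Ω, u x * div ξ x)

/-- The divergence of the vector field `(ξ, η)` on `ℝ² × ℝ`. -/
noncomputable def liftedDiv (ξ : Plane × ℝ → Plane) (η : Plane × ℝ → ℝ) (p : Plane × ℝ) : ℝ :=
  div (fun y => ξ (y, p.2)) p.1 + deriv (fun t => η (p.1, t)) p.2

/-- The total variation of `φ` in `Ω × ℝ`; the fields `(ξ, η)` are bounded by `1` in the
Euclidean norm of `ℝ³`. -/
noncomputable def liftedTV (Ω : Set Plane) (φ : Plane × ℝ → ℝ) : ENNReal :=
  ⨆ (ξ : Plane × ℝ → Plane) (η : Plane × ℝ → ℝ)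
    (_ : IsTest (Ω ×ˢ (univ : Set ℝ)) ξ) (_ : IsTest (Ω ×ˢ (univ : Set ℝ)) η)
    (_ : ∀ p, ‖ξ p‖ ^ 2 + η p ^ 2 ≤ 1),
    ENNReal.ofReal (∫ p in Ω ×ˢ (univ : Set ℝ), φ p * liftedDiv ξ η p)

/-- The set `C'` of `{0,1}`-valued functions of bounded variation on `Ω × ℝ` that are `1` for
`γ ≤ 0`, `0` for `γ ≥ 1` and nonincreasing in `γ` in the sense of distributions. As usual for
`BV`, functions matter up to null sets. Such functions are not integrable over `Ω × (-∞, 0]`, so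
bounded variation means: locally integrable (automatic for measurable `{0,1}`-valued functions)
with finite total variation. -/
structure IsLifted (Ω : Set Plane) (φ : Plane × ℝ → ℝ) : Prop where
  aestronglyMeasurable : AEStronglyMeasurable φ (volume.restrict (Ω ×ˢ (univ : Set ℝ)))
  zero_or_one : ∀ᵐ p ∂(volume.restrict (Ω ×ˢ (univ : Set ℝ))), φ p = 0 ∨ φ p = 1
  finite_variation : liftedTV Ω φ < ⊤
  eq_one : ∀ᵐ p ∂(volume.restrict (Ω ×ˢ Iic (0 : ℝ))), φ p = 1
  eq_zero : ∀ᵐ p ∂(volume.restrict (Ω ×ˢ Ici (1 : ℝ))), φ p = 0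
  nonincreasing : ∀ w : Plane × ℝ → ℝ, IsTest (Ω ×ˢ (univ : Set ℝ)) w → (∀ p, 0 ≤ w p) →
    0 ≤ ∫ p in Ω ×ˢ (univ : Set ℝ), φ p * deriv (fun t => w (p.1, t)) p.2

/-- `m` is the finite Borel measure on `Ω × ℝ` that represents `-D_γ φ`:
`∫ φ ∂_γ w = ∫ w dm` for all test functions `w`. At most one measure does. -/
structure IsNegDerivGamma (Ω : Set Plane) (φ : Plane × ℝ → ℝ) (m : Measure (Plane × ℝ)) :
    Prop where
  finite : m univ < ⊤
  concentrated : m (Ω ×ˢ (univ : Set ℝ))ᶜ = 0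
  integral_eq : ∀ w : Plane × ℝ → ℝ, IsTest (Ω ×ˢ (univ : Set ℝ)) w →
    ∫ p in Ω ×ˢ (univ : Set ℝ), φ p * deriv (fun t => w (p.1, t)) p.2 = ∫ p, w p ∂m

open Classical in
/-- The measure `-D_γ φ` (it exists for every `φ` in `C'`; the value `0` elsewhere is not used). -/
noncomputable def negDerivGamma (Ω : Set Plane) (φ : Plane × ℝ → ℝ) : Measure (Plane × ℝ) :=
  if h : ∃ m, IsNegDerivGamma Ω φ m then h.choose else 0

/-- The histogram `μ^φ(A) = |Ω|⁻¹ (-D_γ φ)(Ω × A)`, `A ⊆ [0,1]`. -/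
noncomputable def histogram (Ω : Set Plane) (φ : Plane × ℝ → ℝ) : Measure ℝ :=
  (volume Ω)⁻¹ •
    ((negDerivGamma Ω φ).restrict (Ω ×ˢ Icc (0 : ℝ) 1)).map Prod.snd

/-- The integral `∫ g⁺ dμ - ∫ g⁻ dμ` in `[-∞, ∞]`, equal to `-∞` if both terms are infinite. -/
noncomputable def extIntegral {α : Type*} [MeasurableSpace α] (μ : Measure α) (g : α → ℝ) :
    EReal :=
  ((∫⁻ x, ENNReal.ofReal (g x) ∂μ : ENNReal) : EReal) -
    ((∫⁻ x, ENNReal.ofReal (-g x) ∂μ : ENNReal) : EReal)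

/-- The set `D` of dual potentials for the cost `c`: Borel functions, integrable on `[0,1]`. -/
def dualSet (c : ℝ → ℝ → ℝ) : Set ((ℝ → ℝ) × (ℝ → ℝ)) :=
  {p | Measurable p.1 ∧ Measurable p.2 ∧
    IntegrableOn p.1 (Icc 0 1) ∧ IntegrableOn p.2 (Icc 0 1) ∧
    ∀ γ₁ ∈ Icc (0 : ℝ) 1, ∀ γ₂ ∈ Icc (0 : ℝ) 1, p.1 γ₁ - p.2 γ₂ ≤ c γ₁ γ₂}

/-- The lifted energy `E'(φ, ψ, ψ')`. Potentials in `D` need not be integrable for `μ^φ` or `μ⁰`;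
`∫ ψ dμ^φ - ∫ ψ' dμ⁰` is written as `∫ ψ dμ^φ + ∫ (-ψ') dμ⁰` so that, since `⊤ + ⊥ = ⊥`
in `EReal`, a pair for which the expression is undefined gets the value `-∞` and does not
contribute to the supremum over `D`. -/
noncomputable def liftedEnergy (Ω : Set Plane) (f : ℝ → Plane → ℝ) (lam nu : ℝ) (μ₀ : Measure ℝ)
    (φ : Plane × ℝ → ℝ) (ψ ψ' : ℝ → ℝ) : EReal :=
  extIntegral ((negDerivGamma Ω φ).restrict (Ω ×ˢ Icc (0 : ℝ) 1)) (fun p => f p.2 p.1)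
    + (lam : EReal) * ((∫⁻ γ in Icc (0 : ℝ) 1, TV Ω (fun x => φ (x, γ)) : ENNReal) : EReal)
    + (nu : EReal) *
      (extIntegral (histogram Ω φ) ψ + extIntegral μ₀ (fun γ => -ψ' γ))

end LiftedWasserstein

/-!
Every `φ` in `C'` is almost everywhere the indicator of the subgraph of a measurable function
`u : Ω → [0, 1]`, and `-D_γ φ` is the image of Lebesgue measure on `Ω` under `x ↦ (x, u x)`. The
energy is therefore a functional of `u`: a data term `∫_Ω f (u x, x)`, the coarea integral
`∫₀¹ TV(1_{u > γ}) dγ`, and the dual value of the optimal transport between `μ⁰` and the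
distribution of `u`. The coarea integral dominates `TV(u)`, so by the Fréchet–Kolmogorov argument a
minimising sequence has a subsequence that converges almost everywhere. By Kantorovich duality the
supremum over the potentials does not change when they are required to be continuous, and for fixed
continuous potentials the transport term is continuous under almost everywhere convergence of `u`.
The supremum is thus lower semicontinuous, and the direct method applies.
-/

open Filter Topology CompactlySupported ProbabilityTheory

namespace LiftedWasserstein

section SegAvg

variable {E : Type*} [NormedAddCommGroup E] [NormedSpace ℝ E] {w : E → ℝ}

/-- The average of `w` over the segment from `y - h` to `y`. Its derivative in the direction `h` is
a difference quotient of `w`, which turns test functions into translations. -/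
noncomputable def segAvg (h : E) (w : E → ℝ) (y : E) : ℝ := ∫ s in (0 : ℝ)..1, w (y - s • h)

/-- The points `x` such that the segment from `x` to `x + h` stays in `U`. -/
def segInterior (h : E) (U : Set E) : Set E := {x | ∀ s ∈ Icc (0 : ℝ) 1, x + s • h ∈ U}

lemma isOpen_segInterior {U : Set E} (hU : IsOpen U) (h : E) : IsOpen (segInterior h U) := by
  refine isOpen_iff_mem_nhds.2 fun x hx =>
    isCompact_Icc.eventually_forall_of_forall_eventually fun s hs => ?_
  have hcont : Continuous fun q : E × ℝ => q.1 + q.2 • h := by fun_prop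
  exact hcont.continuousAt.eventually (hU.mem_nhds (hx s hs))

lemma abs_segAvg_le (hw : ∀ x, |w x| ≤ 1) (h y : E) : |segAvg h w y| ≤ 1 := by
  have := intervalIntegral.norm_integral_le_of_norm_le_const (a := (0 : ℝ)) (b := 1) (C := 1)
    (f := fun s => w (y - s • h)) (fun s _ => hw _)
  simpa [segAvg] using this

lemma segAvg_nonneg (hw : ∀ x, 0 ≤ w x) (h y : E) : 0 ≤ segAvg h w y :=
  intervalIntegral.integral_nonneg zero_le_one fun _ _ => hw _

lemma tsupport_segAvg_subset (hc : HasCompactSupport w) (h : E) :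
    tsupport (segAvg h w) ⊆ (fun q : ℝ × E => q.2 + q.1 • h) '' (Icc (0 : ℝ) 1 ×ˢ tsupport w) := by
  refine closure_minimal (fun y hy => ?_)
    ((isCompact_Icc.prod hc).image (by fun_prop)).isClosed
  contrapose! hy
  rw [Function.notMem_support, segAvg, intervalIntegral.integral_congr (g := fun _ => 0)]
  · simp
  · intro s hs
    rw [uIcc_of_le zero_le_one] at hs
    by_contra hne
    exact hy ⟨(s, y - s • h), ⟨hs, subset_tsupport _ hne⟩, by simp⟩

lemma hasCompactSupport_segAvg (hc : HasCompactSupport w) (h : E) :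
    HasCompactSupport (segAvg h w) :=
  ((isCompact_Icc.prod hc).image (by fun_prop)).of_isClosed_subset
    (isClosed_tsupport _) (tsupport_segAvg_subset hc h)

variable [MeasurableSpace E] [BorelSpace E]

lemma contDiff_segAvg (hw : ContDiff ℝ 1 w) (hc : HasCompactSupport w) (h : E) :
    ContDiff ℝ 1 (segAvg h w) := by
  let μ : Measure E := (volume.restrict (Ioc (0 : ℝ) 1)).map (fun s : ℝ => s • h)
  have hcont : Continuous (fun s : ℝ => s • h) := by fun_prop
  have : IsFiniteMeasure μ := Measure.isFiniteMeasure_map _ _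
  have segAvg_eq : segAvg h w
      = convolution (fun _ : E => (1 : ℝ)) w (ContinuousLinearMap.lsmul ℝ ℝ) μ := by
    ext y
    simp only [segAvg, convolution, ContinuousLinearMap.lsmul_apply, one_smul]
    rw [intervalIntegral.integral_of_le zero_le_one, integral_map hcont.aemeasurable]
    have : Continuous fun t : E => w (y - t) := hw.continuous.comp (by fun_prop)
    exact (this.stronglyMeasurable_of_hasCompactSupport
      (hc.comp_homeomorph (Homeomorph.subLeft y))).aestronglyMeasurable
  rw [segAvg_eq]
  exact hc.contDiff_convolution_right _ (locallyIntegrable_const 1) hw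

lemma fderiv_segAvg_apply (hw : ContDiff ℝ 1 w) (hc : HasCompactSupport w) (h y : E) :
    fderiv ℝ (segAvg h w) y h = w y - w (y - h) := by
  let k : ℝ → ℝ := fun r => w (y - r • h)
  have hk : Continuous k := hw.continuous.comp (by fun_prop)
  have segAvg_line (t : ℝ) : segAvg h w (y + t • h)
      = (∫ r in (0 : ℝ)..(1 - t), k r) - ∫ r in (0 : ℝ)..(0 - t), k r := by
    rw [intervalIntegral.integral_interval_sub_left (hk.intervalIntegrable _ _)
      (hk.intervalIntegrable _ _), ← intervalIntegral.integral_comp_sub_right k t]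
    refine intervalIntegral.integral_congr fun s _ => ?_
    simp only [k]
    congr 1
    module
  have hasDerivAt_primitive (b : ℝ) :
      HasDerivAt (fun t : ℝ => ∫ r in (0 : ℝ)..(b - t), k r) (-k b) 0 := by
    have hF : HasDerivAt (fun x => ∫ r in (0 : ℝ)..x, k r) (k (b - 0)) (b - 0) :=
      intervalIntegral.integral_hasDerivAt_right (hk.intervalIntegrable _ _)
        (hk.stronglyMeasurableAtFilter _ _) hk.continuousAt
    simpa [Function.comp_def] using
      hF.comp (0 : ℝ) (h := fun t => b - t) ((hasDerivAt_id (0 : ℝ)).const_sub b)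
  have hasDerivAt_line :
      HasDerivAt (fun t : ℝ => segAvg h w (y + t • h)) (fderiv ℝ (segAvg h w) y h) 0 := by
    have hl : HasDerivAt (fun t : ℝ => y + t • h) h 0 := by
      simpa using ((hasDerivAt_id (0 : ℝ)).smul_const h).const_add y
    have := (((contDiff_segAvg hw hc h).differentiable one_ne_zero
      (y + (0 : ℝ) • h)).hasFDerivAt).comp_hasDerivAt (0 : ℝ) hl
    simpa only [Function.comp_def, zero_smul, add_zero] using this
  rw [hasDerivAt_line.unique (((hasDerivAt_primitive 1).sub
    (hasDerivAt_primitive 0)).congr_of_eventuallyEq (Eventually.of_forall segAvg_line))]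
  simp only [k, sub_zero, one_smul, zero_smul]
  ring

lemma IsTest.segAvg {U : Set E} {h : E} (hw : IsTest (segInterior h U) w) :
    IsTest U (segAvg h w) where
  contDiff := contDiff_segAvg hw.contDiff hw.hasCompactSupport h
  hasCompactSupport := hasCompactSupport_segAvg hw.hasCompactSupport h
  tsupport_subset := by
    refine (tsupport_segAvg_subset hw.hasCompactSupport h).trans ?_
    rintro _ ⟨⟨s, x⟩, ⟨hs, hx⟩, rfl⟩
    exact hw.tsupport_subset hx s hs

lemma integral_mul_fderiv_segAvg [SecondCountableTopology E] {μ : Measure E}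
    [μ.IsAddRightInvariant] {v : E → ℝ} (hv : LocallyIntegrable v μ) (hw : ContDiff ℝ 1 w)
    (hc : HasCompactSupport w) (h : E) :
    ∫ x, v x * fderiv ℝ (segAvg h w) x h ∂μ = ∫ x, (v x - v (x + h)) * w x ∂μ := by
  have integrable_mul {k : E → ℝ} (hk : Continuous k) (hkc : HasCompactSupport k) :
      Integrable (fun x => v x * k x) μ := by
    simpa only [smul_eq_mul, mul_comm] using hv.integrable_smul_left_of_hasCompactSupport hk hkc
  have hvw := integrable_mul hw.continuous hc
  have hvw' := integrable_mul (k := fun x => w (x - h)) (hw.continuous.comp (by fun_prop))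
    (hc.comp_homeomorph (Homeomorph.subRight h))
  have hshift : ∫ x, v x * w (x - h) ∂μ = ∫ x, v (x + h) * w x ∂μ := by
    simpa using (integral_add_right_eq_self (μ := μ) (fun x => v x * w (x - h)) h).symm
  have hv'w : Integrable (fun x => v (x + h) * w x) μ := by simpa using hvw'.comp_add_right h
  simp only [fderiv_segAvg_apply hw hc, mul_sub, sub_mul]
  rw [integral_sub hvw hvw', hshift, integral_sub hvw hv'w]

end SegAvg

section Mollification

variable {E : Type*} [NormedAddCommGroup E] [NormedSpace ℝ E] [FiniteDimensional ℝ E]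
  [MeasurableSpace E] {μ : Measure E} {s : E → ℝ}

/-- The convolution of `s` with a smooth probability density supported in the ball of radius `δ`. -/
noncomputable def mollify (μ : Measure E) (s : E → ℝ) (δ : ℝ) (hδ : 0 < δ) : E → ℝ :=
  convolution ((⟨δ / 2, δ, half_pos hδ, half_lt_self hδ⟩ : ContDiffBump (0 : E)).normed μ) s
    (ContinuousLinearMap.lsmul ℝ ℝ) μ

lemma mollify_nonneg (hs0 : ∀ x, 0 ≤ s x) {δ : ℝ} (hδ : 0 < δ) (x : E) :
    0 ≤ mollify μ s δ hδ x := by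
  let φ : ContDiffBump (0 : E) := ⟨δ / 2, δ, half_pos hδ, half_lt_self hδ⟩
  change 0 ≤ ∫ t, φ.normed μ t * s (x - t) ∂μ
  exact integral_nonneg fun t => mul_nonneg (φ.nonneg_normed t) (hs0 (x - t))

variable [BorelSpace E] [μ.IsAddHaarMeasure]

lemma contDiff_mollify (hs : LocallyIntegrable s μ) {δ : ℝ} (hδ : 0 < δ) :
    ContDiff ℝ 1 (mollify μ s δ hδ) :=
  let φ : ContDiffBump (0 : E) := ⟨δ / 2, δ, half_pos hδ, half_lt_self hδ⟩
  φ.hasCompactSupport_normed.contDiff_convolution_left _ φ.contDiff_normed hs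

lemma tsupport_mollify_subset {δ : ℝ} (hδ : 0 < δ) {K : Set E} (hsK : ∀ x ∉ K, s x = 0) :
    tsupport (mollify μ s δ hδ) ⊆ Metric.cthickening δ K := by
  refine closure_minimal (fun y hy => ?_) Metric.isClosed_cthickening
  obtain ⟨a, ha, b, hb, rfl⟩ :=
    support_convolution_subset_swap (ContinuousLinearMap.lsmul ℝ ℝ : ℝ →L[ℝ] ℝ →L[ℝ] ℝ) hy
  rw [ContDiffBump.support_normed_eq] at hb
  refine Metric.mem_cthickening_of_dist_le _ a δ K (not_imp_comm.1 (hsK a) ha) ?_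
  simpa using (mem_ball_zero_iff.1 hb).le

lemma abs_mollify_le (hs1 : ∀ x, |s x| ≤ 1) {δ : ℝ} (hδ : 0 < δ) (x : E) :
    |mollify μ s δ hδ x| ≤ 1 := by
  let φ : ContDiffBump (0 : E) := ⟨δ / 2, δ, half_pos hδ, half_lt_self hδ⟩
  calc |∫ t, φ.normed μ t * s (x - t) ∂μ| ≤ ∫ t, φ.normed μ t ∂μ := by
        rw [← Real.norm_eq_abs]
        refine norm_integral_le_of_norm_le φ.integrable_normed
          (Eventually.of_forall fun t => ?_)
        rw [norm_mul, Real.norm_of_nonneg (φ.nonneg_normed t)]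
        exact mul_le_of_le_one_right (φ.nonneg_normed t) (hs1 _)
    _ = 1 := φ.integral_normed

lemma ae_tendsto_mollify (hs : LocallyIntegrable s μ) {δ : ℕ → ℝ} (hδ : ∀ n, 0 < δ n)
    (hδ0 : Tendsto δ atTop (𝓝 0)) :
    ∀ᵐ x ∂μ, Tendsto (fun n => mollify μ s (δ n) (hδ n) x) atTop (𝓝 (s x)) :=
  ContDiffBump.ae_convolution_tendsto_right_of_locallyIntegrable (K := 2) hδ0
    (Eventually.of_forall fun n => (mul_div_cancel₀ (δ n) two_ne_zero).ge) hs

lemma exists_isTest_tendsto_integral_mul {U : Set E} (hU : IsOpen U) {K : Set E} (hK : IsCompact K)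
    (hKU : K ⊆ U) (hs : AEStronglyMeasurable s μ) (hs1 : ∀ x, |s x| ≤ 1) (hsK : ∀ x ∉ K, s x = 0) :
    ∃ w : ℕ → E → ℝ, (∀ n, IsTest U (w n)) ∧ (∀ n x, |w n x| ≤ 1) ∧
      ((∀ x, 0 ≤ s x) → ∀ n x, 0 ≤ w n x) ∧
      ∀ d, LocallyIntegrable d μ →
        Tendsto (fun n => ∫ x, d x * w n x ∂μ) atTop (𝓝 (∫ x, d x * s x ∂μ)) := by
  have hsloc : LocallyIntegrable s μ :=
    (locallyIntegrable_const (1 : ℝ)).mono hs (Eventually.of_forall fun x => by simpa using hs1 x)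
  obtain ⟨δ, hδ, hδU⟩ := hK.exists_cthickening_subset_open hU hKU
  let r : ℕ → ℝ := fun n => δ / (n + 1)
  have hr (n) : 0 < r n := by positivity
  have hrδ (n) : r n ≤ δ := div_le_self hδ.le (by simp)
  have hr0 : Tendsto r atTop (𝓝 0) := by
    simpa [r, div_eq_mul_inv] using tendsto_one_div_add_atTop_nhds_zero_nat.const_mul δ
  have hsupp (n) : tsupport (mollify μ s (r n) (hr n)) ⊆ Metric.cthickening δ K :=
    (tsupport_mollify_subset (hr n) hsK).trans (Metric.cthickening_mono (hrδ n) K)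
  have hcont (n) : ContDiff ℝ 1 (mollify μ s (r n) (hr n)) := contDiff_mollify hsloc (hr n)
  refine ⟨fun n => mollify μ s (r n) (hr n), fun n => ⟨hcont n,
    hK.cthickening.of_isClosed_subset (isClosed_tsupport _) (hsupp n), (hsupp n).trans hδU⟩,
    fun n => abs_mollify_le hs1 (hr n), fun h0 n => mollify_nonneg h0 (hr n), fun d hd => ?_⟩
  refine tendsto_integral_of_dominated_convergence
    ((Metric.cthickening δ K).indicator fun x => ‖d x‖)
    (fun n => hd.aestronglyMeasurable.mul (hcont n).continuous.aestronglyMeasurable)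
    ((integrable_indicator_iff hK.cthickening.measurableSet).2
      (hd.integrableOn_isCompact hK.cthickening).norm)
    (fun n => Eventually.of_forall fun x => ?_) ?_
  · by_cases hx : x ∈ Metric.cthickening δ K
    · rw [indicator_of_mem hx, norm_mul]
      exact mul_le_of_le_one_right (norm_nonneg _) (abs_mollify_le hs1 (hr n) x)
    · rw [indicator_of_notMem hx]
      simp [image_eq_zero_of_notMem_tsupport fun h => hx (hsupp n h)]
  · filter_upwards [ae_tendsto_mollify hsloc hr hr0] with x hx using hx.const_mul _

end Mollification

section Translation

variable {E : Type*} [NormedAddCommGroup E] [NormedSpace ℝ E] [FiniteDimensional ℝ E]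
  [MeasurableSpace E] [BorelSpace E] {μ : Measure E} [μ.IsAddHaarMeasure] {v : E → ℝ}
  {U K : Set E} {h : E}

lemma locallyIntegrable_comp_add_right (hv : LocallyIntegrable v μ) (h : E) :
    LocallyIntegrable (fun x => v (x + h)) μ := by
  refine locallyIntegrable_iff.2 fun K hK => ?_
  have hpre : (fun x => x + h) ⁻¹' ((fun x => x + h) '' K) = K :=
    preimage_image_eq _ (add_left_injective h)
  rw [← hpre]
  exact ((measurePreserving_add_right μ h).integrableOn_comp_preimage
    (measurableEmbedding_addRight h)).2 (hv.integrableOn_isCompact (hK.image (by fun_prop)))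

lemma exists_isTest_tendsto_integral_mul_fderiv (hv : LocallyIntegrable v μ) (hU : IsOpen U)
    (hK : IsCompact K) (hKU : K ⊆ segInterior h U) {s : E → ℝ} (hs : AEStronglyMeasurable s μ)
    (hs1 : ∀ x, |s x| ≤ 1) (hsK : ∀ x ∉ K, s x = 0) :
    ∃ w : ℕ → E → ℝ, (∀ n, IsTest U (w n)) ∧ (∀ n x, |w n x| ≤ 1) ∧
      ((∀ x, 0 ≤ s x) → ∀ n x, 0 ≤ w n x) ∧
      Tendsto (fun n => ∫ x, v x * fderiv ℝ (w n) x h ∂μ) atTop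
        (𝓝 (∫ x, (v x - v (x + h)) * s x ∂μ)) := by
  obtain ⟨w, hw, hw1, hw0, hlim⟩ :=
    exists_isTest_tendsto_integral_mul (isOpen_segInterior hU h) hK hKU hs hs1 hsK
  refine ⟨fun n => segAvg h (w n), fun n => (hw n).segAvg, fun n => abs_segAvg_le (hw1 n) h,
    fun h0 n => segAvg_nonneg (hw0 h0 n) h, ?_⟩
  simp only [integral_mul_fderiv_segAvg hv (hw _).contDiff (hw _).hasCompactSupport]
  exact hlim _ (hv.sub (locallyIntegrable_comp_add_right hv h))

lemma setIntegral_abs_translate_sub_le (hv : LocallyIntegrable v μ) (hU : IsOpen U)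
    (hK : IsCompact K) (hKU : K ⊆ segInterior h U) {C : ℝ}
    (hC : ∀ w, IsTest U w → (∀ x, |w x| ≤ 1) → ∫ x, v x * fderiv ℝ w x h ∂μ ≤ C) :
    ∫ x in K, |v (x + h) - v x| ∂μ ≤ C := by
  let d : E → ℝ := fun x => v x - v (x + h)
  have hd : AEMeasurable d μ :=
    (hv.sub (locallyIntegrable_comp_add_right hv h)).aestronglyMeasurable.aemeasurable
  obtain ⟨w, hw, hw1, -, hlim⟩ := exists_isTest_tendsto_integral_mul_fderiv hv hU hK hKU
    (s := K.indicator fun x => d x / |d x|)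
    ((hd.div hd.norm).indicator hK.measurableSet).aestronglyMeasurable
    (fun x => (norm_indicator_le_norm_self (fun x => d x / |d x|) x).trans (by
      rw [norm_div, ← Real.norm_eq_abs, norm_norm]; exact div_self_le_one _))
    (fun x hx => indicator_of_notMem hx _)
  calc ∫ x in K, |v (x + h) - v x| ∂μ = ∫ x, d x * K.indicator (fun x => d x / |d x|) x ∂μ := by
        rw [← integral_indicator hK.measurableSet]
        refine integral_congr_ae (Eventually.of_forall fun x => ?_)
        by_cases hx : x ∈ K
        · simp only [indicator_of_mem hx, abs_sub_comm (v (x + h))]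
          rw [← mul_div_assoc, ← abs_mul_abs_self, mul_self_div_self]
        · simp [hx]
    _ ≤ C := le_of_tendsto' hlim fun n => hC _ (hw n) (hw1 n)

lemma ae_le_of_integral_mul_fderiv_nonneg (hv : LocallyIntegrable v μ) (hU : IsOpen U)
    (hpos : ∀ w, IsTest U w → (∀ x, 0 ≤ w x) → 0 ≤ ∫ x, v x * fderiv ℝ w x h ∂μ) :
    ∀ᵐ x ∂μ, x ∈ segInterior h U → v (x + h) ≤ v x := by
  let d : E → ℝ := fun x => v x - v (x + h)
  have hd : LocallyIntegrable d μ := hv.sub (locallyIntegrable_comp_add_right hv h)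
  have ae_nonneg {K : Set E} (hK : IsCompact K) (hKU : K ⊆ segInterior h U) :
      ∀ᵐ x ∂μ, x ∈ K → 0 ≤ d x := by
    obtain ⟨w, hw, -, hw0, hlim⟩ := exists_isTest_tendsto_integral_mul_fderiv hv hU hK hKU
      (s := K.indicator ({x | d x < 0}.indicator 1))
      ((aestronglyMeasurable_one.indicator₀ (nullMeasurableSet_lt
        hd.aestronglyMeasurable.aemeasurable aemeasurable_const)).indicator hK.measurableSet)
      (fun x => by by_cases hx : x ∈ K <;> by_cases hdx : d x < 0 <;> simp [hx, hdx])
      (fun x hx => indicator_of_notMem hx _)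
    have hnonneg := ge_of_tendsto' hlim fun n => hpos _ (hw n) (hw0 (fun x =>
      indicator_nonneg (fun _ _ => indicator_nonneg (fun _ _ => zero_le_one) _) x) n)
    have hneg : ∫ x in K, max (-d x) 0 ∂μ ≤ 0 := by
      rw [← integral_indicator hK.measurableSet, ← neg_nonneg, ← integral_neg]
      refine hnonneg.trans_eq (integral_congr_ae (Eventually.of_forall fun x => ?_))
      change d x * _ = _
      by_cases hx : x ∈ K
      · rcases lt_or_ge (d x) 0 with hdx | hdx
        · simp [hx, hdx, hdx.le]
        · simp [hx, hdx, hdx.not_gt]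
      · simp [hx]
    have hzero := (setIntegral_eq_zero_iff_of_nonneg_ae (μ := μ) (s := K)
      (Eventually.of_forall fun x => le_max_right (-d x) 0)
      (hd.integrableOn_isCompact hK).neg_part).1
        (hneg.antisymm (integral_nonneg fun x => le_max_right _ _))
    filter_upwards [(ae_restrict_iff' hK.measurableSet).1 hzero] with x hx hxK
    simpa using hx hxK
  refine measure_null_of_locally_null _ fun x hx => ?_
  obtain ⟨hxU, -⟩ := Classical.not_imp.1 hx
  obtain ⟨K, hKx, hKU, hK⟩ :=
    local_compact_nhds ((isOpen_segInterior hU h).mem_nhds hxU)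
  refine ⟨_, inter_mem_nhdsWithin _ hKx, measure_mono_null ?_ (ae_nonneg hK hKU)⟩
  rintro y ⟨hy, hyK⟩
  simp only [mem_compl_iff, mem_ofPred_eq, Classical.not_imp, not_le] at hy ⊢
  exact ⟨hyK, sub_neg.2 hy.2⟩

end Translation

section Slices

lemma ae_mem_iff_lt_volume_of_ae_antitone {A : Set ℝ} (hA : MeasurableSet A)
    (hmono : ∀ᵐ s : ℝ, ∀ᵐ t : ℝ, s < t → t ∈ A → s ∈ A)
    (h0 : ∀ᵐ t : ℝ, t ≤ 0 → t ∈ A) (h1 : ∀ᵐ t : ℝ, 1 ≤ t → t ∉ A) :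
    ∀ᵐ t : ℝ, t ∈ A ↔ t < volume.real (A ∩ Icc 0 1) := by
  have hfin : volume (A ∩ Icc 0 1) ≠ ⊤ := measure_ne_top_of_subset inter_subset_right (by simp)
  have hle_one : volume.real (A ∩ Icc 0 1) ≤ 1 :=
    (measureReal_mono inter_subset_right (by simp)).trans_eq (by simp)
  have hmono' : ∀ᵐ t : ℝ, ∀ᵐ s : ℝ, s < t → t ∈ A → s ∈ A := by
    rwa [Measure.ae_ae_comm]
    exact (measurableSet_lt measurable_snd measurable_fst).imp
      ((measurable_fst hA).imp (measurable_snd hA))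
  filter_upwards [hmono, hmono', h0, h1,
    compl_mem_ae_iff.2 (measure_singleton (volume.real (A ∩ Icc 0 1)))] with t ht ht' h0 h1 hne
  rcases lt_or_ge t 0 with htneg | htpos
  · exact iff_of_true (h0 htneg.le) (htneg.trans_le measureReal_nonneg)
  rcases le_or_gt 1 t with ht1 | ht1
  · exact iff_of_false (h1 ht1) (not_lt.2 (hle_one.trans ht1))
  by_cases htA : t ∈ A
  · refine iff_of_true htA (lt_of_le_of_ne ?_ hne)
    have hsub : Ioo 0 t ≤ᵐ[volume] (A ∩ Icc 0 1 : Set ℝ) := by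
      filter_upwards [ht'] with s hs hst
      exact ⟨hs hst.2 htA, hst.1.le, (hst.2.trans ht1).le⟩
    have := measure_mono_ae hsub
    rw [Real.volume_Ioo, sub_zero] at this
    exact (ENNReal.ofReal_le_iff_le_toReal hfin).1 this
  · refine iff_of_false htA (not_lt.2 (ENNReal.toReal_le_of_le_ofReal htpos ?_))
    have hsub : (A ∩ Icc 0 1 : Set ℝ) ≤ᵐ[volume] Icc 0 t := by
      filter_upwards [ht] with s hs hsA
      exact ⟨hsA.2.1, not_lt.1 fun hts => htA (hs hts hsA.1)⟩
    simpa using measure_mono_ae hsub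

lemma ae_ae_of_forall_ae_add {X : Type*} [MeasurableSpace X] {ν : Measure X} [SFinite ν]
    {E : Set (X × ℝ)} (hE : MeasurableSet E)
    (h : ∀ r : ℝ, 0 < r → ∀ᵐ p ∂(ν.prod volume), (p.1, p.2 + r) ∈ E → p ∈ E) :
    ∀ᵐ x ∂ν, ∀ᵐ s : ℝ, ∀ᵐ t : ℝ, s < t → (x, t) ∈ E → (x, s) ∈ E := by
  refine Measure.ae_ae_of_ae_prod (p := fun p : X × ℝ =>
    ∀ᵐ t : ℝ, p.2 < t → (p.1, t) ∈ E → p ∈ E) ?_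
  have hshift : ∀ᵐ p ∂(ν.prod volume), ∀ᵐ r : ℝ, 0 < r → (p.1, p.2 + r) ∈ E → p ∈ E := by
    rw [Measure.ae_ae_comm]
    · refine Eventually.of_forall fun r => ?_
      by_cases hr : 0 < r
      · filter_upwards [h r hr] with p hp _ using hp
      · exact Eventually.of_forall fun p hr' => (hr hr').elim
    · have hadd : Measurable fun q : (X × ℝ) × ℝ => (q.1.1, q.1.2 + q.2) := by fun_prop
      exact (measurableSet_lt measurable_const measurable_snd).imp
        ((hadd hE).imp (measurable_fst hE))
  filter_upwards [hshift] with p hp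
  filter_upwards [(measurePreserving_sub_right (volume : Measure ℝ)
    p.2).quasiMeasurePreserving.ae hp] with t ht hpt htE
  refine ht (sub_pos.2 hpt) ?_
  rwa [add_sub_cancel]

end Slices

section Subgraph

variable {E : Type*} [NormedAddCommGroup E] [NormedSpace ℝ E] {X : Type*}

lemma deriv_snd_eq_fderiv {w : E × ℝ → ℝ} {p : E × ℝ} (hw : DifferentiableAt ℝ w p) :
    deriv (fun t => w (p.1, t)) p.2 = fderiv ℝ w p (0, 1) :=
  (hw.hasFDerivAt.comp_hasDerivAt p.2
    ((hasDerivAt_const p.2 p.1).prodMk (hasDerivAt_id p.2))).deriv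

lemma mem_segInterior_prod_univ {Ω : Set E} {r : ℝ} {p : E × ℝ} (hp : p.1 ∈ Ω) :
    p ∈ segInterior ((0 : E), r) (Ω ×ˢ (univ : Set ℝ)) := fun s _ => by simpa using hp

/-- The indicator function of the region below the graph of `u`. Up to null sets, the elements of
the set `C'` are of this form. -/
noncomputable def subgraphFn (u : X → ℝ) : X × ℝ → ℝ :=
  {q : X × ℝ | q.2 < u q.1}.indicator 1

lemma measurableSet_subgraph [MeasurableSpace X] {u : X → ℝ} (hu : Measurable u) :
    MeasurableSet {q : X × ℝ | q.2 < u q.1} :=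
  measurableSet_lt measurable_snd (hu.comp measurable_fst)

instance : (volume : Measure (Plane × ℝ)).IsAddHaarMeasure :=
  Measure.prod.instIsAddHaarMeasure volume volume

variable {Ω : Set Plane} {φ : Plane × ℝ → ℝ}

lemma IsLifted.exists_measurableSet (hΩ : IsOpen Ω) (hφ : IsLifted Ω φ) :
    ∃ A ⊆ Ω ×ˢ (univ : Set ℝ), MeasurableSet A ∧
      φ =ᵐ[volume.restrict (Ω ×ˢ (univ : Set ℝ))] A.indicator 1 := by
  have hU : MeasurableSet (Ω ×ˢ (univ : Set ℝ)) := hΩ.measurableSet.prod MeasurableSet.univ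
  have hm := hφ.aestronglyMeasurable
  refine ⟨(Ω ×ˢ univ) ∩ hm.mk φ ⁻¹' {1}, inter_subset_left,
    hU.inter (hm.stronglyMeasurable_mk.measurable (measurableSet_singleton 1)), ?_⟩
  filter_upwards [hm.ae_eq_mk, hφ.zero_or_one, ae_restrict_mem hU] with p hmk h01 hp
  rcases h01 with h | h
  · rw [indicator_of_notMem (fun hA => by simpa [← hmk, h] using hA.2), h]
  · have hmem : p ∈ (Ω ×ˢ univ) ∩ hm.mk φ ⁻¹' {1} := ⟨hp, by simp [← hmk, h]⟩
    rw [indicator_of_mem hmem, h, Pi.one_apply]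

lemma IsLifted.ae_mem_of_add_mem (hΩ : IsOpen Ω) (hφ : IsLifted Ω φ) {A : Set (Plane × ℝ)}
    (hAΩ : A ⊆ Ω ×ˢ univ) (hA : MeasurableSet A)
    (hφA : φ =ᵐ[volume.restrict (Ω ×ˢ (univ : Set ℝ))] A.indicator 1) {r : ℝ} (hr : 0 < r) :
    ∀ᵐ p : Plane × ℝ, (p.1, p.2 + r) ∈ A → p ∈ A := by
  have hloc : LocallyIntegrable (A.indicator (1 : Plane × ℝ → ℝ)) :=
    (locallyIntegrable_const (1 : ℝ)).indicator hA
  have hmono := ae_le_of_integral_mul_fderiv_nonneg (h := ((0 : Plane), r)) hloc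
    (hΩ.prod isOpen_univ) fun w hw hw0 => ?_
  · filter_upwards [hmono] with p hp hpA
    have := hp (mem_segInterior_prod_univ (hAΩ hpA).1)
    contrapose! this
    have hadd : p + (0, r) = (p.1, p.2 + r) := by ext <;> simp
    simp [hadd, hpA, this]
  · calc (0 : ℝ) ≤ r * ∫ p in Ω ×ˢ (univ : Set ℝ), φ p * deriv (fun t => w (p.1, t)) p.2 :=
          mul_nonneg hr.le (hφ.nonincreasing w hw hw0)
      _ = ∫ p in Ω ×ˢ (univ : Set ℝ), A.indicator 1 p * fderiv ℝ w p (0, r) := by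
          rw [← integral_const_mul]
          refine integral_congr_ae ?_
          filter_upwards [hφA] with p hp
          have hr : ((0 : Plane), r) = r • ((0 : Plane), (1 : ℝ)) := by simp
          rw [hp, deriv_snd_eq_fderiv (hw.contDiff.differentiable one_ne_zero p), hr, map_smul,
            smul_eq_mul, mul_left_comm]
      _ = ∫ p, A.indicator 1 p * fderiv ℝ w p (0, r) :=
          setIntegral_eq_integral_of_forall_compl_eq_zero fun p hp => by
            rw [indicator_of_notMem fun h => hp (hAΩ h), zero_mul]

lemma IsLifted.exists_ae_eq_subgraphFn (hΩ : IsOpen Ω) (hφ : IsLifted Ω φ) :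
    ∃ u : Plane → ℝ, Measurable u ∧ (∀ x, u x ∈ Icc (0 : ℝ) 1) ∧
      φ =ᵐ[volume.restrict (Ω ×ˢ (univ : Set ℝ))] subgraphFn u := by
  obtain ⟨A, hAΩ, hA, hφA⟩ := hφ.exists_measurableSet hΩ
  let u : Plane → ℝ := fun x => volume.real ((fun t => (x, t)) ⁻¹' A ∩ Icc (0 : ℝ) 1)
  have hu : Measurable u := (measurable_measure_prodMk_left (ν := (volume : Measure ℝ))
    (hA.inter (measurable_snd (measurableSet_Icc (a := (0 : ℝ)) (b := 1))))).ennreal_toReal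
  have hu01 (x) : u x ∈ Icc (0 : ℝ) 1 := ⟨measureReal_nonneg,
    (measureReal_mono inter_subset_right (by simp)).trans_eq (by simp)⟩
  have hslice {I : Set ℝ} (hI : MeasurableSet I) {a : ℝ}
      (h : ∀ᵐ p ∂(volume.restrict (Ω ×ˢ I)), φ p = a) :
      ∀ᵐ x : Plane, ∀ᵐ t : ℝ, x ∈ Ω → t ∈ I → A.indicator 1 (x, t) = a := by
    refine Measure.ae_ae_of_ae_prod (p := fun p : Plane × ℝ => p.1 ∈ Ω → p.2 ∈ I →
      A.indicator 1 p = a) ?_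
    filter_upwards [(ae_restrict_iff' (hΩ.measurableSet.prod hI)).1 h,
      (ae_restrict_iff' (hΩ.measurableSet.prod MeasurableSet.univ)).1 hφA] with p h₁ h₂ hpΩ hpI
    rw [← h₂ ⟨hpΩ, mem_univ _⟩, h₁ ⟨hpΩ, hpI⟩]
  have hiff : ∀ᵐ p : Plane × ℝ, p.1 ∈ Ω → (p ∈ A ↔ p.2 < u p.1) := by
    refine (Measure.ae_prod_iff_ae_ae ((measurable_fst hΩ.measurableSet).imp
      (hA.iff (measurableSet_subgraph hu)))).2 ?_
    filter_upwards [ae_ae_of_forall_ae_add hA fun r hr => hφ.ae_mem_of_add_mem hΩ hAΩ hA hφA hr,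
      hslice measurableSet_Iic hφ.eq_one, hslice measurableSet_Ici hφ.eq_zero] with x hmono h0 h1
    by_cases hx : x ∈ Ω
    · refine (ae_mem_iff_lt_volume_of_ae_antitone (measurable_prodMk_left hA) hmono ?_ ?_).mono
        fun t ht _ => ht
      · filter_upwards [h0] with t ht ht0 using (indicator_eq_one_iff_mem ℝ).1 (ht hx ht0)
      · filter_upwards [h1] with t ht ht1 using (indicator_eq_zero_iff_notMem ℝ).1 (ht hx ht1)
    · exact Eventually.of_forall fun t ht => (hx ht).elim
  refine ⟨u, hu, hu01, hφA.trans ?_⟩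
  refine (ae_restrict_iff' (hΩ.measurableSet.prod MeasurableSet.univ)).2
    (hiff.mono fun p hp hpΩ => ?_)
  by_cases hpA : p ∈ A
  · rw [subgraphFn, indicator_of_mem hpA, indicator_of_mem (by exact (hp hpΩ.1).1 hpA)]
  · rw [subgraphFn, indicator_of_notMem hpA,
      indicator_of_notMem (by exact fun h => hpA ((hp hpΩ.1).2 h))]

end Subgraph

section TestFunctions

variable {E F : Type*} [NormedAddCommGroup E] [NormedSpace ℝ E] [NormedAddCommGroup F]
  [NormedSpace ℝ F] {U : Set E} {w : E → ℝ}

lemma IsTest.prodMk_right {Ω : Set E} {ξ : E × ℝ → F} (hξ : IsTest (Ω ×ˢ (univ : Set ℝ)) ξ)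
    (γ : ℝ) : IsTest Ω fun y => ξ (y, γ) := by
  have hsub : tsupport (fun y => ξ (y, γ)) ⊆ (fun y => (y, γ)) ⁻¹' tsupport ξ :=
    closure_minimal (fun y hy => subset_tsupport ξ hy)
      ((isClosed_tsupport ξ).preimage (by fun_prop))
  refine ⟨hξ.contDiff.comp (by fun_prop), ?_, fun y hy => (hξ.tsupport_subset (hsub hy)).1⟩
  refine HasCompactSupport.intro (hξ.hasCompactSupport.isCompact.image continuous_fst)
    fun y hy => ?_
  by_contra h
  exact hy ⟨(y, γ), subset_tsupport _ h, rfl⟩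

lemma hasCompactSupport_prodMk_left {X G : Type*} [TopologicalSpace X] [Zero G] {k : X × ℝ → G}
    (hk : HasCompactSupport k) (x : X) : HasCompactSupport fun t => k (x, t) := by
  refine HasCompactSupport.intro (hk.isCompact.image continuous_snd) fun t ht => ?_
  by_contra h
  exact ht ⟨(x, t), subset_tsupport _ h, rfl⟩

lemma fderiv_prodMk_right_apply {k : E × ℝ → ℝ} {p : E × ℝ} (hk : DifferentiableAt ℝ k p)
    (v : E) : fderiv ℝ (fun y => k (y, p.2)) p.1 v = fderiv ℝ k p (v, 0) := by
  have hslice : HasFDerivAt (fun y : E => (y, p.2)) ((ContinuousLinearMap.id ℝ E).prod 0) p.1 :=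
    (hasFDerivAt_id p.1).prodMk (hasFDerivAt_const p.2 p.1)
  have hcomp : HasFDerivAt (fun y => k (y, p.2)) _ p.1 := hk.hasFDerivAt.comp p.1 hslice
  simp [hcomp.fderiv]

lemma IsTest.differentiable {ξ : E → F} (hξ : IsTest U ξ) : Differentiable ℝ ξ :=
  hξ.contDiff.differentiable one_ne_zero

lemma IsTest.continuousLinearMap_comp {G : Type*} [NormedAddCommGroup G] [NormedSpace ℝ G]
    {ξ : E → F} (hξ : IsTest U ξ) (L : F →L[ℝ] G) : IsTest U fun x => L (ξ x) := by
  have hsupp : tsupport (fun x => L (ξ x)) ⊆ tsupport ξ :=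
    closure_mono fun x hx hξx => hx (by simp [hξx])
  exact ⟨L.contDiff.comp hξ.contDiff, hξ.hasCompactSupport.comp_left (map_zero L),
    hsupp.trans hξ.tsupport_subset⟩

variable [MeasurableSpace E] [BorelSpace E] {μ : Measure E}

lemma IsTest.integrable [IsFiniteMeasureOnCompacts μ] (hw : IsTest U w) : Integrable w μ :=
  hw.contDiff.continuous.integrable_of_hasCompactSupport hw.hasCompactSupport

lemma IsTest.integrable_fderiv_apply [IsFiniteMeasureOnCompacts μ] (hw : IsTest U w) (v : E) :
    Integrable (fun x => fderiv ℝ w x v) μ :=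
  Continuous.integrable_of_hasCompactSupport
    ((hw.contDiff.continuous_fderiv one_ne_zero).clm_apply continuous_const)
    (hw.hasCompactSupport.fderiv_apply ℝ v)

lemma IsTest.integral_fderiv_apply_eq_zero [FiniteDimensional ℝ E] [μ.IsAddHaarMeasure]
    (hw : IsTest U w) (v : E) : ∫ x, fderiv ℝ w x v ∂μ = 0 := by
  simpa using integral_mul_fderiv_eq_neg_fderiv_mul_of_integrable (μ := μ) (f := fun _ => (1 : ℝ))
    (g := w) (v := v) (by simp) (by simpa using hw.integrable_fderiv_apply v)
    (by simpa using hw.integrable) (fun x _ => differentiableAt_const _)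
    (fun x _ => hw.differentiable x)

lemma ext_of_forall_isTest_integral_eq [FiniteDimensional ℝ E] (hU : IsOpen U)
    {m₁ m₂ : Measure E} [IsFiniteMeasure m₁] [IsFiniteMeasure m₂] (h₁ : m₁ Uᶜ = 0)
    (h₂ : m₂ Uᶜ = 0) (h : ∀ w : E → ℝ, IsTest U w → ∫ x, w x ∂m₁ = ∫ x, w x ∂m₂) :
    m₁ = m₂ := by
  let μ : Measure E := m₁ + m₂
  have hac₁ : m₁ ≪ μ := Measure.AbsolutelyContinuous.rfl.add_right m₂
  have hac₂ : m₂ ≪ μ := Measure.absolutelyContinuous_of_le (Measure.le_add_left le_rfl)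
  let d₁ : E → ℝ := fun x => (m₁.rnDeriv μ x).toReal
  let d₂ : E → ℝ := fun x => (m₂.rnDeriv μ x).toReal
  have hd₁ : Integrable d₁ μ := Measure.integrable_toReal_rnDeriv
  have hd₂ : Integrable d₂ μ := Measure.integrable_toReal_rnDeriv
  have hzero : ∀ᵐ x ∂μ, x ∈ U → (d₁ - d₂) x = 0 := by
    refine hU.ae_eq_zero_of_integral_contDiff_smul_eq_zero
      ((hd₁.sub hd₂).locallyIntegrable.locallyIntegrableOn _) fun w hw hwc hwU => ?_
    obtain ⟨C, hC⟩ := hw.continuous.bounded_above_of_compact_support hwc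
    have integrable_mul {k : E → ℝ} (hk : Integrable k μ) : Integrable (fun x => k x * w x) μ :=
      hk.mul_bdd hw.continuous.aestronglyMeasurable (Eventually.of_forall hC)
    calc ∫ x, w x • (d₁ - d₂) x ∂μ = (∫ x, d₁ x * w x ∂μ) - ∫ x, d₂ x * w x ∂μ := by
          rw [← integral_sub (integrable_mul hd₁) (integrable_mul hd₂)]
          simp only [Pi.sub_apply, smul_eq_mul, mul_sub, mul_comm]
      _ = (∫ x, w x ∂m₁) - ∫ x, w x ∂m₂ := by
          simp only [← integral_rnDeriv_smul hac₁, ← integral_rnDeriv_smul hac₂, smul_eq_mul,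
            d₁, d₂]
      _ = 0 := sub_eq_zero.2 (h w ⟨hw.of_le (by simp), hwc, hwU⟩)
  have hmem : ∀ᵐ x ∂μ, x ∈ U := by
    change μ Uᶜ = 0
    rw [Measure.add_apply, h₁, h₂, add_zero]
  have hrn : m₁.rnDeriv μ =ᵐ[μ] m₂.rnDeriv μ := by
    filter_upwards [hzero, hmem, Measure.rnDeriv_lt_top m₁ μ, Measure.rnDeriv_lt_top m₂ μ]
      with x hx hxU hfin₁ hfin₂
    exact (ENNReal.toReal_eq_toReal_iff' hfin₁.ne hfin₂.ne).1 (sub_eq_zero.1 (hx hxU))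
  rw [← Measure.withDensity_rnDeriv_eq _ _ hac₁, ← Measure.withDensity_rnDeriv_eq _ _ hac₂,
    withDensity_congr_ae hrn]

end TestFunctions

section GraphMeasure

variable {Ω : Set Plane} {φ : Plane × ℝ → ℝ} {u : Plane → ℝ}

lemma IsNegDerivGamma.unique (hΩ : IsOpen Ω) {m₁ m₂ : Measure (Plane × ℝ)}
    (h₁ : IsNegDerivGamma Ω φ m₁) (h₂ : IsNegDerivGamma Ω φ m₂) : m₁ = m₂ :=
  have : IsFiniteMeasure m₁ := ⟨h₁.finite⟩
  have : IsFiniteMeasure m₂ := ⟨h₂.finite⟩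
  ext_of_forall_isTest_integral_eq (hΩ.prod isOpen_univ) h₁.concentrated h₂.concentrated
    fun w hw => (h₁.integral_eq w hw).symm.trans (h₂.integral_eq w hw)

lemma measurable_subgraphFn {X : Type*} [MeasurableSpace X] {u : X → ℝ} (hu : Measurable u) :
    Measurable (subgraphFn u) :=
  measurable_one.indicator (measurableSet_subgraph hu)

lemma subgraphFn_of_lt {X : Type*} {u : X → ℝ} {x : X} {t : ℝ} (h : t < u x) :
    subgraphFn u (x, t) = 1 :=
  indicator_of_mem (s := {q : X × ℝ | q.2 < u q.1}) h _

lemma subgraphFn_of_le {X : Type*} {u : X → ℝ} {x : X} {t : ℝ} (h : u x ≤ t) :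
    subgraphFn u (x, t) = 0 :=
  indicator_of_notMem (s := {q : X × ℝ | q.2 < u q.1}) (not_lt.2 h) _

lemma subgraphFn_mem_Icc {X : Type*} (u : X → ℝ) (p : X × ℝ) : subgraphFn u p ∈ Icc (0 : ℝ) 1 :=
  ⟨indicator_nonneg (fun _ _ => zero_le_one) p, indicator_le_self' (fun _ _ => zero_le_one) p⟩

lemma abs_subgraphFn_le_one {X : Type*} (u : X → ℝ) (p : X × ℝ) : |subgraphFn u p| ≤ 1 :=
  abs_le.2 ⟨by linarith [(subgraphFn_mem_Icc u p).1], (subgraphFn_mem_Icc u p).2⟩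

lemma integrable_subgraphFn_mul (hu : Measurable u) {k : Plane × ℝ → ℝ} (hk : Integrable k) :
    Integrable fun p => subgraphFn u p * k p :=
  hk.bdd_mul (measurable_subgraphFn hu).aestronglyMeasurable
    (Eventually.of_forall (abs_subgraphFn_le_one u))

lemma integral_subgraphFn_mul_deriv {X : Type*} (u : X → ℝ) (x : X) {k : ℝ → ℝ}
    (hk : ContDiff ℝ 1 k) (hkc : HasCompactSupport k) :
    ∫ t, subgraphFn u (x, t) * deriv k t = k (u x) := by
  have : (fun t => subgraphFn u (x, t) * deriv k t) = (Iio (u x)).indicator (deriv k) := by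
    ext t
    rcases lt_or_ge t (u x) with ht | ht
    · rw [subgraphFn_of_lt ht, one_mul, indicator_of_mem (mem_Iio.2 ht)]
    · rw [subgraphFn_of_le ht, zero_mul, indicator_of_notMem (notMem_Iio.2 ht)]
  rw [this, integral_indicator measurableSet_Iio, ← integral_Iic_eq_integral_Iio,
    hkc.integral_Iic_deriv_eq hk]

lemma IsTest.integrable_deriv_snd {U : Set (Plane × ℝ)} {w : Plane × ℝ → ℝ} (hw : IsTest U w) :
    Integrable fun p : Plane × ℝ => deriv (fun t => w (p.1, t)) p.2 := by
  simpa only [deriv_snd_eq_fderiv (hw.differentiable _)] using hw.integrable_fderiv_apply (0, 1)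

/-- The image of Lebesgue measure on `Ω` under `x ↦ (x, u x)`. It is `-D_γ φ` for the indicator
function `φ` of the subgraph of `u`. -/
noncomputable def graphMeasure (Ω : Set Plane) (u : Plane → ℝ) : Measure (Plane × ℝ) :=
  (volume.restrict Ω).map fun x => (x, u x)

lemma setIntegral_subgraphFn_mul_deriv_snd (hu : Measurable u) {w : Plane × ℝ → ℝ}
    (hw : IsTest (Ω ×ˢ univ) w) :
    ∫ p in Ω ×ˢ (univ : Set ℝ), subgraphFn u p * deriv (fun t => w (p.1, t)) p.2
      = ∫ p, w p ∂(graphMeasure Ω u) := by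
  rw [Measure.volume_eq_prod, setIntegral_prod _
    (integrable_subgraphFn_mul hu hw.integrable_deriv_snd).integrableOn, graphMeasure,
    integral_map (by fun_prop) hw.contDiff.continuous.aestronglyMeasurable]
  refine integral_congr_ae (Eventually.of_forall fun x => ?_)
  simp only [Measure.restrict_univ]
  exact integral_subgraphFn_mul_deriv u x (hw.contDiff.comp (by fun_prop))
    (hasCompactSupport_prodMk_left hw.hasCompactSupport x)

lemma isNegDerivGamma_graphMeasure (hΩ : IsOpen Ω) (hΩ_fin : volume Ω ≠ ⊤) (hu : Measurable u)
    (hφ : φ =ᵐ[volume.restrict (Ω ×ˢ (univ : Set ℝ))] subgraphFn u) :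
    IsNegDerivGamma Ω φ (graphMeasure Ω u) where
  finite := by
    rw [graphMeasure, Measure.map_apply (by fun_prop) MeasurableSet.univ]
    simpa using hΩ_fin.lt_top
  concentrated := by
    rw [graphMeasure, Measure.map_apply (by fun_prop)
      (hΩ.measurableSet.prod MeasurableSet.univ).compl]
    simp only [preimage_compl, mk_preimage_prod, preimage_id', preimage_univ, inter_univ]
    rw [Measure.restrict_apply hΩ.measurableSet.compl, compl_inter_self, measure_empty]
  integral_eq w hw := by
    rw [← setIntegral_subgraphFn_mul_deriv_snd hu hw]
    exact integral_congr_ae (hφ.mono fun p hp => by simp only [hp])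

lemma negDerivGamma_eq (hΩ : IsOpen Ω) (hΩ_fin : volume Ω ≠ ⊤) (hu : Measurable u)
    (hφ : φ =ᵐ[volume.restrict (Ω ×ˢ (univ : Set ℝ))] subgraphFn u) :
    negDerivGamma Ω φ = graphMeasure Ω u := by
  have h := isNegDerivGamma_graphMeasure hΩ hΩ_fin hu hφ
  have hex : ∃ m, IsNegDerivGamma Ω φ m := ⟨_, h⟩
  rw [negDerivGamma, dif_pos hex]
  exact hex.choose_spec.unique hΩ h

end GraphMeasure

section TotalVariation

variable {Ω : Set Plane} {ξ : Plane → Plane} {v : Plane → ℝ}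

lemma div_eq_sum_fderiv_apply {x : Plane} (hξ : DifferentiableAt ℝ ξ x) :
    div ξ x = ∑ i : Fin 2, fderiv ℝ (fun y => ξ y i) x (EuclideanSpace.single i 1) := by
  refine Finset.sum_congr rfl fun i _ => ?_
  have hcomp : HasFDerivAt (fun y => ξ y i) _ x :=
    (EuclideanSpace.proj (𝕜 := ℝ) i).hasFDerivAt.comp x hξ.hasFDerivAt
  rw [hcomp.fderiv]
  rfl

lemma div_smul_const {a : Plane → ℝ} {x : Plane} (ha : DifferentiableAt ℝ a x) (h : Plane) :
    div (fun y => a y • h) x = fderiv ℝ a x h := by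
  have hsum : h = ∑ i : Fin 2, h i • (EuclideanSpace.single i 1 : Plane) := by
    ext j
    fin_cases j <;> simp
  have hfderiv : fderiv ℝ (fun y => a y • h) x = (fderiv ℝ a x).smulRight h :=
    (ha.hasFDerivAt.smul_const h).fderiv
  conv_rhs => rw [hsum, map_sum]
  refine Finset.sum_congr rfl fun i _ => ?_
  simp [hfderiv, mul_comm]

lemma IsTest.apply {E : Type*} [NormedAddCommGroup E] [NormedSpace ℝ E] {U : Set E} {ξ : E → Plane}
    (hξ : IsTest U ξ) (i : Fin 2) : IsTest U fun y => ξ y i :=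
  hξ.continuousLinearMap_comp (EuclideanSpace.proj (𝕜 := ℝ) i)

lemma continuous_div (hξ : ContDiff ℝ 1 ξ) : Continuous (div ξ) := by
  have := hξ.continuous_fderiv one_ne_zero
  unfold div
  fun_prop

lemma hasCompactSupport_div (hξ : HasCompactSupport ξ) : HasCompactSupport (div ξ) :=
  (hξ.fderiv ℝ).comp_left
    (g := fun L : Plane →L[ℝ] Plane => ∑ i : Fin 2, (L (EuclideanSpace.single i 1)) i) (by simp)

lemma IsTest.integrable_div (hξ : IsTest Ω ξ) : Integrable (div ξ) :=
  (continuous_div hξ.contDiff).integrable_of_hasCompactSupport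
    (hasCompactSupport_div hξ.hasCompactSupport)

lemma IsTest.div_eq_zero_of_notMem (hξ : IsTest Ω ξ) {x : Plane} (hx : x ∉ Ω) : div ξ x = 0 := by
  have hfderiv : fderiv ℝ ξ x = 0 :=
    Function.notMem_support.1 fun h => hx (hξ.tsupport_subset (support_fderiv_subset ℝ h))
  simp [div, hfderiv]

lemma IsTest.setIntegral_mul_div_eq_integral (hξ : IsTest Ω ξ) (v : Plane → ℝ) :
    ∫ x in Ω, v x * div ξ x = ∫ x, v x * div ξ x :=
  setIntegral_eq_integral_of_forall_compl_eq_zero fun x hx => by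
    rw [hξ.div_eq_zero_of_notMem hx, mul_zero]

lemma IsTest.integral_div_eq_zero (hξ : IsTest Ω ξ) : ∫ x, div ξ x = 0 := by
  simp only [fun x => div_eq_sum_fderiv_apply (hξ.differentiable x)]
  rw [integral_finsetSum _ fun i _ => (hξ.apply i).integrable_fderiv_apply _]
  exact Finset.sum_eq_zero fun i _ => (hξ.apply i).integral_fderiv_apply_eq_zero _

lemma TV_le_iff {C : ENNReal} : TV Ω v ≤ C ↔ ∀ ξ : Plane → Plane, IsTest Ω ξ → (∀ x, ‖ξ x‖ ≤ 1) →
    ENNReal.ofReal (∫ x in Ω, v x * div ξ x) ≤ C := by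
  simp only [TV, iSup_le_iff]

lemma ofReal_setIntegral_mul_div_le_TV (hξ : IsTest Ω ξ) (hξ₁ : ∀ x, ‖ξ x‖ ≤ 1) :
    ENNReal.ofReal (∫ x in Ω, v x * div ξ x) ≤ TV Ω v :=
  TV_le_iff.1 le_rfl ξ hξ hξ₁

lemma TV_congr_ae {v' : Plane → ℝ} (h : v =ᵐ[volume.restrict Ω] v') : TV Ω v = TV Ω v' := by
  have hint (ξ : Plane → Plane) : ∫ x in Ω, v x * div ξ x = ∫ x in Ω, v' x * div ξ x :=
    integral_congr_ae (h.mono fun x hx => congrArg (· * div ξ x) hx)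
  simp only [TV, hint]

lemma TV_const (Ω : Set Plane) (a : ℝ) : TV Ω (fun _ => a) = 0 := by
  refine le_antisymm (TV_le_iff.2 fun ξ hξ _ => ?_) zero_le
  rw [hξ.setIntegral_mul_div_eq_integral, integral_const_mul, hξ.integral_div_eq_zero, mul_zero,
    ENNReal.ofReal_zero]

lemma div_neg (ξ : Plane → Plane) (x : Plane) : div (fun y => -ξ y) x = -div ξ x := by
  simp [div, fderiv_fun_neg]

lemma IsTest.integrable_mul_div (hξ : IsTest Ω ξ) {μ : Measure Plane} (hv : Integrable v μ) :
    Integrable (fun x => v x * div ξ x) μ := by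
  have hdiv := continuous_div hξ.contDiff
  obtain ⟨C, hC⟩ :=
    hdiv.bounded_above_of_compact_support (hasCompactSupport_div hξ.hasCompactSupport)
  exact hv.mul_bdd hdiv.aestronglyMeasurable (Eventually.of_forall hC)

lemma TV_sub_le {v' : Plane → ℝ} (hv : IntegrableOn v Ω) (hv' : IntegrableOn v' Ω) :
    TV Ω (fun x => v x - v' x) ≤ TV Ω v + TV Ω v' := by
  refine TV_le_iff.2 fun ξ hξ hξ₁ => ?_
  have hξ_neg : IsTest Ω fun x => -ξ x :=
    hξ.continuousLinearMap_comp (-ContinuousLinearMap.id ℝ Plane)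
  have hsplit : ∫ x in Ω, (v x - v' x) * div ξ x =
      (∫ x in Ω, v x * div ξ x) + ∫ x in Ω, v' x * div (fun y => -ξ y) x := by
    rw [← integral_add (hξ.integrable_mul_div hv) (hξ_neg.integrable_mul_div hv')]
    simp only [div_neg, sub_mul, mul_neg, ← sub_eq_add_neg]
  rw [hsplit]
  exact ENNReal.ofReal_add_le.trans (add_le_add (ofReal_setIntegral_mul_div_le_TV hξ hξ₁)
    (ofReal_setIntegral_mul_div_le_TV hξ_neg (by simpa only [norm_neg] using hξ₁)))

lemma TV_le_liminf {u : ℕ → Plane → ℝ} (h : ∀ ξ : Plane → Plane, IsTest Ω ξ →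
    Tendsto (fun n => ∫ x in Ω, u n x * div ξ x) atTop (𝓝 (∫ x in Ω, v x * div ξ x))) :
    TV Ω v ≤ liminf (fun n => TV Ω (u n)) atTop := by
  refine TV_le_iff.2 fun ξ hξ hξ₁ => ?_
  rw [← (ENNReal.tendsto_ofReal (h ξ hξ)).liminf_eq]
  exact liminf_le_liminf (Eventually.of_forall fun n => ofReal_setIntegral_mul_div_le_TV hξ hξ₁)

end TotalVariation

section LiftedTotalVariation

variable {Ω : Set Plane} {u : Plane → ℝ}

/-- `∫₀¹ TV(1_{u > γ}) dγ`; by the coarea formula this is the total variation of `u` when `u` takes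
its values in `[0, 1]`. -/
noncomputable def coareaIntegral (Ω : Set Plane) (u : Plane → ℝ) : ENNReal :=
  ∫⁻ γ in Icc (0 : ℝ) 1, TV Ω fun x => subgraphFn u (x, γ)

lemma ofReal_integral_le_lintegral {α : Type*} [MeasurableSpace α] {μ : Measure α} {k : α → ℝ}
    (hk : Integrable k μ) : ENNReal.ofReal (∫ x, k x ∂μ) ≤ ∫⁻ x, ENNReal.ofReal (k x) ∂μ := by
  rw [integral_eq_lintegral_pos_part_sub_lintegral_neg_part hk]
  exact (ENNReal.ofReal_le_ofReal (sub_le_self _ ENNReal.toReal_nonneg)).trans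
    ENNReal.ofReal_toReal_le

lemma TV_subgraphFn_eq_zero (hu : ∀ x, u x ∈ Icc (0 : ℝ) 1) {γ : ℝ} (hγ : γ ∉ Icc (0 : ℝ) 1) :
    TV Ω (fun x => subgraphFn u (x, γ)) = 0 := by
  rcases lt_or_ge γ 0 with h | h
  · simp only [fun x => subgraphFn_of_lt (h.trans_le (hu x).1), TV_const]
  · have h₁ : 1 < γ := not_le.1 fun h₁ => hγ ⟨h, h₁⟩
    simp only [fun x => subgraphFn_of_le ((hu x).2.trans h₁.le), TV_const]

lemma lintegral_TV_subgraphFn (hu : ∀ x, u x ∈ Icc (0 : ℝ) 1) :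
    ∫⁻ γ, TV Ω (fun x => subgraphFn u (x, γ)) = coareaIntegral Ω u :=
  (setLIntegral_eq_of_support_subset fun γ hγ => by
    by_contra h
    exact hγ (TV_subgraphFn_eq_zero hu h)).symm

lemma IsTest.integrable_div_prodMk_right {U : Set (Plane × ℝ)} {ξ : Plane × ℝ → Plane}
    (hξ : IsTest U ξ) : Integrable fun p : Plane × ℝ => div (fun y => ξ (y, p.2)) p.1 := by
  have hdiv (p : Plane × ℝ) : div (fun y => ξ (y, p.2)) p.1
      = ∑ i : Fin 2, fderiv ℝ (fun q => ξ q i) p (EuclideanSpace.single i 1, 0) := by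
    have hslice : DifferentiableAt ℝ (fun y => ξ (y, p.2)) p.1 :=
      (hξ.differentiable p).comp p.1 (by fun_prop : DifferentiableAt ℝ (fun y => (y, p.2)) p.1)
    rw [div_eq_sum_fderiv_apply hslice]
    exact Finset.sum_congr rfl fun i _ =>
      fderiv_prodMk_right_apply ((hξ.apply i).differentiable p) _
  simp only [hdiv]
  exact integrable_finsetSum _ fun i _ => (hξ.apply i).integrable_fderiv_apply _

lemma ofReal_setIntegral_subgraphFn_mul_div_le (hu : Measurable u)
    (hu₁ : ∀ x, u x ∈ Icc (0 : ℝ) 1) {ξ : Plane × ℝ → Plane}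
    (hξ : IsTest (Ω ×ˢ (univ : Set ℝ)) ξ) (hξ₁ : ∀ p, ‖ξ p‖ ≤ 1) :
    ENNReal.ofReal
      (∫ p in Ω ×ˢ (univ : Set ℝ), subgraphFn u p * div (fun y => ξ (y, p.2)) p.1)
        ≤ coareaIntegral Ω u := by
  have hprod : volume.restrict (Ω ×ˢ (univ : Set ℝ)) = (volume.restrict Ω).prod volume := by
    rw [Measure.volume_eq_prod, ← Measure.prod_restrict, Measure.restrict_univ]
  have hint : Integrable (fun p : Plane × ℝ => subgraphFn u p * div (fun y => ξ (y, p.2)) p.1)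
      ((volume.restrict Ω).prod volume) := by
    rw [← hprod]
    exact (integrable_subgraphFn_mul hu hξ.integrable_div_prodMk_right).restrict
  rw [hprod, integral_prod_symm _ hint, ← lintegral_TV_subgraphFn hu₁]
  exact (ofReal_integral_le_lintegral hint.integral_prod_right).trans
    (lintegral_mono fun γ => ofReal_setIntegral_mul_div_le_TV (hξ.prodMk_right γ)
      fun x => hξ₁ (x, γ))

lemma IsNegDerivGamma.ofReal_setIntegral_mul_deriv_le {φ : Plane × ℝ → ℝ}
    {m : Measure (Plane × ℝ)} (hm : IsNegDerivGamma Ω φ m) {η : Plane × ℝ → ℝ}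
    (hη : IsTest (Ω ×ˢ (univ : Set ℝ)) η) (hη₁ : ∀ p, |η p| ≤ 1) :
    ENNReal.ofReal
      (∫ p in Ω ×ˢ (univ : Set ℝ), φ p * deriv (fun t => η (p.1, t)) p.2) ≤ m univ := by
  have : IsFiniteMeasure m := ⟨hm.finite⟩
  rw [hm.integral_eq η hη]
  calc ENNReal.ofReal (∫ p, η p ∂m) ≤ ∫⁻ p, ENNReal.ofReal (η p) ∂m :=
        ofReal_integral_le_lintegral hη.integrable
    _ ≤ ∫⁻ _, 1 ∂m := lintegral_mono fun p =>
        ENNReal.ofReal_le_one.2 ((le_abs_self _).trans (hη₁ p))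
    _ = m univ := lintegral_one

lemma liftedTV_subgraphFn_le {m : Measure (Plane × ℝ)}
    (hm : IsNegDerivGamma Ω (subgraphFn u) m) (hu : Measurable u)
    (hu₁ : ∀ x, u x ∈ Icc (0 : ℝ) 1) :
    liftedTV Ω (subgraphFn u) ≤ coareaIntegral Ω u + m univ := by
  refine iSup_le fun ξ => iSup_le fun η => iSup_le fun hξ => iSup_le fun hη => iSup_le fun hb => ?_
  have hξ₁ (p : Plane × ℝ) : ‖ξ p‖ ≤ 1 :=
    (sq_le_one_iff₀ (norm_nonneg _)).1 (by linarith [hb p, sq_nonneg (η p)])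
  have hη₁ (p : Plane × ℝ) : |η p| ≤ 1 :=
    (sq_le_one_iff_abs_le_one _).1 (by linarith [hb p, sq_nonneg ‖ξ p‖])
  simp only [liftedDiv, mul_add]
  rw [integral_add (integrable_subgraphFn_mul hu hξ.integrable_div_prodMk_right).integrableOn
    (integrable_subgraphFn_mul hu hη.integrable_deriv_snd).integrableOn]
  exact ENNReal.ofReal_add_le.trans (add_le_add
    (ofReal_setIntegral_subgraphFn_mul_div_le hu hu₁ hξ hξ₁)
    (hm.ofReal_setIntegral_mul_deriv_le hη hη₁))

lemma ae_snd_ne (γ : ℝ) : ∀ᵐ p : Plane × ℝ, p.2 ≠ γ :=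
  (Measure.quasiMeasurePreserving_snd (μ := (volume : Measure Plane))).ae
    (Measure.ae_ne (volume : Measure ℝ) γ)

lemma isLifted_subgraphFn (hΩ : IsOpen Ω) (hΩ_fin : volume Ω ≠ ⊤) (hu : Measurable u)
    (hu₁ : ∀ x, u x ∈ Icc (0 : ℝ) 1) (hTV : coareaIntegral Ω u ≠ ⊤) :
    IsLifted Ω (subgraphFn u) where
  aestronglyMeasurable := (measurable_subgraphFn hu).aestronglyMeasurable
  zero_or_one := Eventually.of_forall fun p => (le_or_gt (u p.1) p.2).imp
    (subgraphFn_of_le (u := u)) subgraphFn_of_lt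
  finite_variation := by
    have hm := isNegDerivGamma_graphMeasure hΩ hΩ_fin hu ae_eq_rfl
    exact (liftedTV_subgraphFn_le hm hu hu₁).trans_lt
      (ENNReal.add_lt_top.2 ⟨hTV.lt_top, hm.finite⟩)
  eq_one := by
    rw [ae_restrict_iff' (hΩ.measurableSet.prod measurableSet_Iic)]
    filter_upwards [ae_snd_ne 0] with p hp hmem
    exact subgraphFn_of_lt ((lt_of_le_of_ne hmem.2 hp).trans_le (hu₁ p.1).1)
  eq_zero := by
    rw [ae_restrict_iff' (hΩ.measurableSet.prod measurableSet_Ici)]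
    exact Eventually.of_forall fun p hmem => subgraphFn_of_le ((hu₁ p.1).2.trans hmem.2)
  nonincreasing w hw hw₀ := by
    rw [(isNegDerivGamma_graphMeasure hΩ hΩ_fin hu ae_eq_rfl).integral_eq w hw]
    exact integral_nonneg hw₀

end LiftedTotalVariation

section LocalAverages

lemma setIntegral_ball_comp_add_left {E : Type*} [NormedAddCommGroup E] [MeasurableSpace E]
    [BorelSpace E] {μ : Measure E} [μ.IsAddLeftInvariant] (v : E → ℝ) (x : E)
    (r : ℝ) : ∫ h in Metric.ball 0 r, v (x + h) ∂μ =
      ∫ y in Metric.ball x r, v y ∂μ := by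
  rw [← (measurePreserving_add_left μ x).setIntegral_preimage_emb (measurableEmbedding_addLeft x)
    v (Metric.ball x r), preimage_add_ball, sub_self]

variable {E : Type*} [NormedAddCommGroup E] [NormedSpace ℝ E] [FiniteDimensional ℝ E]
  [MeasurableSpace E] [BorelSpace E] {μ : Measure E} [μ.IsAddHaarMeasure] {v : E → ℝ} {K B : Set E}

lemma integrable_comp_add_prod (hv : Integrable v μ) (hK : μ K ≠ ⊤) :
    Integrable (fun q : E × E => v (q.1 + q.2)) ((μ.restrict K).prod (μ.restrict B)) := by
  have : IsFiniteMeasure (μ.restrict K) := isFiniteMeasure_restrict.2 hK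
  have hint : Integrable (fun q : E × E => v (q.1 + q.2)) ((μ.restrict K).prod μ) :=
    (measurePreserving_prod_add (μ.restrict K) μ).integrable_comp_of_integrable
      (hv.comp_snd (μ.restrict K))
  exact hint.mono_measure (Measure.prod_mono le_rfl Measure.restrict_le_self)

lemma measureReal_mul_setIntegral_abs_le (hv : Integrable v μ) (hK : μ K ≠ ⊤) (hB : μ B ≠ ⊤) :
    μ.real B * ∫ x in K, |v x| ∂μ ≤
      (∫ h in B, ∫ x in K, |v (x + h) - v x| ∂μ ∂μ) + ∫ x in K, |∫ h in B, v (x + h) ∂μ| ∂μ := by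
  have : IsFiniteMeasure (μ.restrict B) := isFiniteMeasure_restrict.2 hB
  have : IsFiniteMeasure (μ.restrict K) := isFiniteMeasure_restrict.2 hK
  have hadd : Integrable (fun q : E × E => v (q.1 + q.2)) ((μ.restrict K).prod (μ.restrict B)) :=
    integrable_comp_add_prod hv hK
  have hdiff : Integrable (fun q : E × E => |v (q.1 + q.2) - v q.1|)
      ((μ.restrict K).prod (μ.restrict B)) := (hadd.sub (hv.restrict.comp_fst (μ.restrict B))).abs
  have hpointwise (x : E) : μ.real B * |v x| ≤
      (∫ h in B, |v (x + h) - v x| ∂μ) + |∫ h in B, v (x + h) ∂μ| := by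
    have havg : μ.real B * v x = (∫ h in B, v (x + h) ∂μ) - ∫ h in B, (v (x + h) - v x) ∂μ := by
      rw [integral_sub (hv.comp_add_left x).integrableOn (integrable_const _), sub_sub_cancel,
        setIntegral_const, smul_eq_mul]
    calc μ.real B * |v x| = |μ.real B * v x| := by rw [abs_mul, abs_of_nonneg measureReal_nonneg]
      _ ≤ |∫ h in B, v (x + h) ∂μ| + |∫ h in B, (v (x + h) - v x) ∂μ| := by
          rw [havg]; exact abs_sub _ _
      _ ≤ _ := by
          rw [add_comm]
          gcongr
          exact abs_integral_le_integral_abs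
  calc μ.real B * ∫ x in K, |v x| ∂μ
      ≤ ∫ x in K, ((∫ h in B, |v (x + h) - v x| ∂μ) + |∫ h in B, v (x + h) ∂μ|) ∂μ := by
        rw [← integral_const_mul]
        exact integral_mono (hv.restrict.abs.const_mul _)
          (hdiff.integral_prod_left.add hadd.integral_prod_left.abs) hpointwise
    _ = _ := by
        rw [integral_add hdiff.integral_prod_left hadd.integral_prod_left.abs,
          integral_integral_swap hdiff]

lemma tendsto_setIntegral_abs_integral_ball {v : ℕ → E → ℝ} {G : E → ℝ} (hG : Integrable G μ)
    (hv : ∀ n, Integrable (v n) μ) (hvG : ∀ n x, |v n x| ≤ G x)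
    (hK : μ K ≠ ⊤) {r : ℝ}
    (hball : ∀ x, Tendsto (fun n => ∫ y in Metric.ball x r, v n y ∂μ) atTop (𝓝 0)) :
    Tendsto (fun n => ∫ x in K, |∫ h in Metric.ball 0 r, v n (x + h) ∂μ| ∂μ) atTop (𝓝 0) := by
  have : IsFiniteMeasure (μ.restrict K) := isFiniteMeasure_restrict.2 hK
  have hG₀ (x : E) : 0 ≤ G x := (abs_nonneg _).trans (hvG 0 x)
  rw [← integral_zero E ℝ (μ := μ.restrict K)]
  refine tendsto_integral_of_dominated_convergence (fun _ => ∫ y, G y ∂μ) (fun n => ?_)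
    (integrable_const _) (fun n => Eventually.of_forall fun x => ?_)
    (Eventually.of_forall fun x => ?_)
  · exact (integrable_comp_add_prod (hv n) hK).integral_prod_left.abs.aestronglyMeasurable
  · rw [setIntegral_ball_comp_add_left, Real.norm_eq_abs, abs_abs, ← Real.norm_eq_abs]
    exact (norm_integral_le_of_norm_le hG.restrict (Eventually.of_forall (hvG n))).trans
      (setIntegral_le_integral hG (Eventually.of_forall hG₀))
  · simp only [setIntegral_ball_comp_add_left]
    simpa using (hball x).abs

lemma tendsto_setIntegral_abs_of_translate {v : ℕ → E → ℝ} {G : E → ℝ} (hG : Integrable G μ)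
    (hv : ∀ n, AEStronglyMeasurable (v n) μ) (hvG : ∀ n x, |v n x| ≤ G x)
    (hball : ∀ x r, Tendsto (fun n => ∫ y in Metric.ball x r, v n y ∂μ) atTop (𝓝 0))
    (hK : μ K ≠ ⊤) (htrans : ∀ ε > 0, ∃ δ > 0, ∀ n, ∀ h ∈ Metric.ball (0 : E) δ,
      ∫ x in K, |v n (x + h) - v n x| ∂μ ≤ ε) :
    Tendsto (fun n => ∫ x in K, |v n x| ∂μ) atTop (𝓝 0) := by
  have hint (n : ℕ) : Integrable (v n) μ := hG.mono' (hv n) (Eventually.of_forall (hvG n))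
  refine tendsto_order.2 ⟨fun a ha => Eventually.of_forall fun n =>
    ha.trans_le (integral_nonneg fun _ => abs_nonneg _), fun ε hε => ?_⟩
  obtain ⟨δ, hδ, hδ_trans⟩ := htrans (ε / 2) (half_pos hε)
  let B := Metric.ball (0 : E) δ
  have hB : μ B ≠ ⊤ := measure_ball_lt_top.ne
  have hB_pos : 0 < μ.real B := ENNReal.toReal_pos (Metric.measure_ball_pos μ _ hδ).ne' hB
  have : IsFiniteMeasure (μ.restrict B) := isFiniteMeasure_restrict.2 hB
  have : IsFiniteMeasure (μ.restrict K) := isFiniteMeasure_restrict.2 hK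
  have htranslate (n : ℕ) :
      ∫ h in B, ∫ x in K, |v n (x + h) - v n x| ∂μ ∂μ ≤ μ.real B * (ε / 2) := by
    have hdiff := ((integrable_comp_add_prod (B := B) (hint n) hK).sub
      ((hint n).restrict.comp_fst (μ.restrict B))).abs
    calc _ ≤ ∫ _ in B, ε / 2 ∂μ := setIntegral_mono_on hdiff.integral_prod_right
          (integrable_const _) measurableSet_ball (hδ_trans n)
      _ = μ.real B * (ε / 2) := by rw [setIntegral_const, smul_eq_mul]
  have haverage := tendsto_setIntegral_abs_integral_ball hG hint hvG hK fun x => hball x δ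
  filter_upwards [haverage.eventually_lt_const (mul_pos hB_pos (half_pos hε))] with n hn
  refine lt_of_mul_lt_mul_left ?_ hB_pos.le
  calc _ ≤ _ := measureReal_mul_setIntegral_abs_le (hint n) hK hB
    _ < μ.real B * (ε / 2) + μ.real B * (ε / 2) := add_lt_add_of_le_of_lt (htranslate n) hn
    _ = μ.real B * ε := by ring

end LocalAverages

lemma tendsto_setLIntegral_enorm_of_isCompact {E : Type*} [TopologicalSpace E] [T2Space E]
    [MeasurableSpace E] [OpensMeasurableSpace E] {μ : Measure E} [μ.InnerRegularCompactLTTop]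
    {Ω : Set E} (hΩ : MeasurableSet Ω) (hΩ_fin : μ Ω ≠ ⊤) {v : ℕ → E → ℝ} {G : E → ℝ}
    (hG : Integrable G μ)
    (hv : ∀ n, AEStronglyMeasurable (v n) μ) (hvG : ∀ n x, |v n x| ≤ G x)
    (hK : ∀ K ⊆ Ω, IsCompact K → Tendsto (fun n => ∫ x in K, |v n x| ∂μ) atTop (𝓝 0)) :
    Tendsto (fun n => ∫⁻ x in Ω, ‖v n x‖ₑ ∂μ) atTop (𝓝 0) := by
  refine ENNReal.tendsto_nhds_zero.2 fun ε hε => ?_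
  obtain ⟨δ, hδ, hsmall⟩ := exists_pos_setLIntegral_lt_of_measure_lt hG.hasFiniteIntegral.ne
    (ENNReal.half_pos hε.ne').ne'
  obtain ⟨K, hKΩ, hK_compact, hK_diff⟩ := hΩ.exists_isCompact_sdiff_lt hΩ_fin hδ.ne'
  have hlim : Tendsto (fun n => ∫⁻ x in K, ‖v n x‖ₑ ∂μ) atTop (𝓝 0) := by
    have hofReal := ENNReal.tendsto_ofReal (hK K hKΩ hK_compact)
    rw [ENNReal.ofReal_zero] at hofReal
    refine hofReal.congr fun n => ofReal_integral_norm_eq_lintegral_enorm ?_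
    exact (hG.mono' (hv n) (Eventually.of_forall (hvG n))).restrict
  filter_upwards [ENNReal.tendsto_nhds_zero.1 hlim _ (ENNReal.half_pos hε.ne')] with n hn
  calc ∫⁻ x in Ω, ‖v n x‖ₑ ∂μ ≤ (∫⁻ x in K, ‖v n x‖ₑ ∂μ) + ∫⁻ x in Ω \ K, ‖v n x‖ₑ ∂μ := by
        rw [← union_sdiff_cancel hKΩ]
        simpa only [union_sdiff_cancel hKΩ] using lintegral_union_le _ K (Ω \ K)
    _ ≤ ε / 2 + ∫⁻ x in Ω \ K, ‖G x‖ₑ ∂μ := by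
        refine add_le_add hn (lintegral_mono fun x => enorm_le_iff_norm_le.2 ?_)
        exact (hvG n x).trans (Real.le_norm_self _)
    _ ≤ ε / 2 + ε / 2 := by gcongr; exact (hsmall (Ω \ K) hK_diff).le
    _ = ε := ENNReal.add_halves ε

section WeakLimits

lemma exists_subseq_tendsto_inner {H : Type*} [NormedAddCommGroup H] [InnerProductSpace ℝ H]
    [CompleteSpace H] [TopologicalSpace.SeparableSpace H] {U : ℕ → H} {R : ℝ}
    (hU : ∀ n, ‖U n‖ ≤ R) :
    ∃ (W : H) (k : ℕ → ℕ), StrictMono k ∧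
      ∀ g, Tendsto (fun n => inner ℝ (U (k n)) g) atTop (𝓝 (inner ℝ W g)) := by
  let T (n : ℕ) : WeakDual ℝ H := StrongDual.toWeakDual (InnerProductSpace.toDual ℝ H (U n))
  have hT (n : ℕ) : T n ∈ WeakDual.toStrongDual ⁻¹' Metric.closedBall (0 : StrongDual ℝ H) R := by
    rw [mem_preimage, mem_closedBall_zero_iff]
    exact ((InnerProductSpace.toDual ℝ H).norm_map (U n)).trans_le (hU n)
  obtain ⟨S, -, k, hk, hlim⟩ := WeakDual.isSeqCompact_closedBall ℝ H (0 : StrongDual ℝ H) R hT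
  refine ⟨(InnerProductSpace.toDual ℝ H).symm (WeakDual.toStrongDual S), k, hk, fun g => ?_⟩
  rw [InnerProductSpace.toDual_symm_apply]
  exact ((WeakDual.eval_continuous g).tendsto S).comp hlim

lemma exists_subseq_tendsto_integral_mul {α : Type*} [MeasurableSpace α]
    [MeasurableSpace.CountablyGenerated α] {μ : Measure α} [IsFiniteMeasure μ] {u : ℕ → α → ℝ}
    (hu : ∀ n, AEStronglyMeasurable (u n) μ) {C : ℝ} (hC : ∀ n x, |u n x| ≤ C) :
    ∃ (w : α → ℝ) (k : ℕ → ℕ), StrictMono k ∧ Measurable w ∧ MemLp w 2 μ ∧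
      ∀ g : α → ℝ, MemLp g 2 μ →
        Tendsto (fun n => ∫ x, u (k n) x * g x ∂μ) atTop (𝓝 (∫ x, w x * g x ∂μ)) := by
  have hmem (n : ℕ) : MemLp (u n) 2 μ := MemLp.of_bound (hu n) C (Eventually.of_forall (hC n))
  have inner_toLp {a b : α → ℝ} (ha : MemLp a 2 μ) (hb : MemLp b 2 μ) :
      inner ℝ (ha.toLp a) (hb.toLp b) = ∫ x, a x * b x ∂μ := by
    rw [L2.inner_def]
    refine integral_congr_ae ?_
    filter_upwards [ha.coeFn_toLp, hb.coeFn_toLp] with x hax hbx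
    simp [hax, hbx, mul_comm]
  have hnorm (n : ℕ) : ‖(hmem n).toLp (u n)‖ ≤ μ.real univ ^ ((2 : ENNReal).toReal)⁻¹ * |C| := by
    refine Lp.norm_le_of_ae_bound (abs_nonneg C) ?_
    filter_upwards [(hmem n).coeFn_toLp] with x hx
    rw [hx]
    exact (hC n x).trans (le_abs_self C)
  have : Fact ((2 : ENNReal) ≠ ⊤) := ⟨by simp⟩
  obtain ⟨W, k, hk, hlim⟩ := exists_subseq_tendsto_inner hnorm
  have hW := Lp.aestronglyMeasurable W
  have hw : MemLp (hW.mk W) 2 μ := (memLp_congr_ae hW.ae_eq_mk).1 (Lp.memLp W)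
  have hWw : W = hw.toLp (hW.mk W) := Lp.ext (hW.ae_eq_mk.trans hw.coeFn_toLp.symm)
  refine ⟨hW.mk W, k, hk, hW.stronglyMeasurable_mk.measurable, hw, fun g hg => ?_⟩
  have hlim_g := hlim (hg.toLp g)
  rw [hWw] at hlim_g
  simpa only [inner_toLp] using hlim_g

end WeakLimits

section Compactness

variable {Ω K : Set Plane} {v : Plane → ℝ} {C : NNReal}

lemma setIntegral_abs_translate_sub_le_of_TV_le (hΩ : IsOpen Ω) (hv : LocallyIntegrable v)
    (hC : TV Ω v ≤ C) (hK : IsCompact K) {h : Plane} (hKΩ : K ⊆ segInterior h Ω) :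
    ∫ x in K, |v (x + h) - v x| ≤ ‖h‖ * C := by
  rcases eq_or_ne h 0 with rfl | hh
  · simp
  have hh_pos : 0 < ‖h‖ := norm_pos_iff.2 hh
  refine setIntegral_abs_translate_sub_le hv hΩ hK hKΩ fun w hw hw₁ => ?_
  have hξ : IsTest Ω fun x => w x • (‖h‖⁻¹ • h) :=
    hw.continuousLinearMap_comp (ContinuousLinearMap.toSpanSingleton ℝ (‖h‖⁻¹ • h))
  have hξ₁ (x : Plane) : ‖w x • (‖h‖⁻¹ • h)‖ ≤ 1 := by
    rw [norm_smul, norm_smul, norm_inv, norm_norm, inv_mul_cancel₀ hh_pos.ne', mul_one]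
    exact hw₁ x
  have hTV := (ofReal_setIntegral_mul_div_le_TV (v := v) hξ hξ₁).trans hC
  rw [ENNReal.ofReal_le_coe, hξ.setIntegral_mul_div_eq_integral] at hTV
  simp only [fun x => div_smul_const (hw.differentiable x), map_smul, smul_eq_mul,
    mul_left_comm _ ‖h‖⁻¹, integral_const_mul] at hTV
  rwa [inv_mul_le_iff₀ hh_pos] at hTV

lemma exists_pos_forall_subset_segInterior {E : Type*} [NormedAddCommGroup E] [NormedSpace ℝ E]
    {Ω K : Set E} (hΩ : IsOpen Ω) (hK : IsCompact K) (hKΩ : K ⊆ Ω) :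
    ∃ δ > 0, ∀ h ∈ Metric.ball (0 : E) δ, K ⊆ segInterior h Ω := by
  obtain ⟨δ, hδ, hδΩ⟩ := hK.exists_thickening_subset_open hΩ hKΩ
  refine ⟨δ, hδ, fun h hh x hx s hs => hδΩ (Metric.mem_thickening_iff.2 ⟨x, hx, ?_⟩)⟩
  rw [dist_self_add_left, norm_smul, Real.norm_of_nonneg hs.1]
  exact (mul_le_of_le_one_left (norm_nonneg h) hs.2).trans_lt (mem_ball_zero_iff.1 hh)

lemma exists_pos_forall_setIntegral_abs_translate_sub_le (hΩ : IsOpen Ω) {v : ℕ → Plane → ℝ}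
    (hv : ∀ n, LocallyIntegrable (v n)) (hC : ∀ n, TV Ω (v n) ≤ C) (hK : IsCompact K)
    (hKΩ : K ⊆ Ω) {ε : ℝ} (hε : 0 < ε) :
    ∃ δ > 0, ∀ n, ∀ h ∈ Metric.ball (0 : Plane) δ, ∫ x in K, |v n (x + h) - v n x| ≤ ε := by
  obtain ⟨δ, hδ, hδΩ⟩ := exists_pos_forall_subset_segInterior hΩ hK hKΩ
  have hC_pos : (0 : ℝ) < C + 1 := by positivity
  refine ⟨min δ (ε / (C + 1)), lt_min hδ (div_pos hε hC_pos), fun n h hh => ?_⟩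
  have hh_norm := mem_ball_zero_iff.1 hh
  calc ∫ x in K, |v n (x + h) - v n x| ≤ ‖h‖ * C :=
        setIntegral_abs_translate_sub_le_of_TV_le hΩ (hv n) (hC n) hK
          (hδΩ h (mem_ball_zero_iff.2 (hh_norm.trans_le (min_le_left _ _))))
    _ ≤ ε / (C + 1) * (C + 1) := by
        gcongr
        · exact hh_norm.le.trans (min_le_right _ _)
        · linarith
    _ = ε := div_mul_cancel₀ ε hC_pos.ne'

lemma tendsto_setLIntegral_enorm_of_TV_le (hΩ : IsOpen Ω) (hΩ_fin : volume Ω ≠ ⊤)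
    {v : ℕ → Plane → ℝ} {G : Plane → ℝ} (hG : Integrable G)
    (hv : ∀ n, AEStronglyMeasurable (v n) volume) (hvG : ∀ n x, |v n x| ≤ G x)
    (hC : ∀ n, TV Ω (v n) ≤ C)
    (hball : ∀ x r, Tendsto (fun n => ∫ y in Metric.ball x r, v n y) atTop (𝓝 0)) :
    Tendsto (fun n => ∫⁻ x in Ω, ‖v n x‖ₑ) atTop (𝓝 0) :=
  tendsto_setLIntegral_enorm_of_isCompact hΩ.measurableSet hΩ_fin hG hv hvG fun _ hKΩ hK =>
    tendsto_setIntegral_abs_of_translate hG hv hvG hball hK.measure_lt_top.ne fun _ hε =>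
      exists_pos_forall_setIntegral_abs_translate_sub_le hΩ
        (fun n => (hG.mono' (hv n) (Eventually.of_forall (hvG n))).locallyIntegrable)
        hC hK hKΩ hε

lemma tendsto_setIntegral_indicator_sub {α : Type*} [MeasurableSpace α] {μ : Measure α}
    {Ω B : Set α} (hΩ : MeasurableSet Ω) (hB : MeasurableSet B) {u : ℕ → α → ℝ} {w : α → ℝ}
    (hu : ∀ n, IntegrableOn (u n) Ω μ) (hw : IntegrableOn w Ω μ)
    (hlim : Tendsto (fun n => ∫ x in Ω, u n x * B.indicator 1 x ∂μ) atTop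
      (𝓝 (∫ x in Ω, w x * B.indicator 1 x ∂μ))) :
    Tendsto (fun n => ∫ x in B, Ω.indicator (fun x => u n x - w x) x ∂μ) atTop (𝓝 0) := by
  have hint (q : α → ℝ) : ∫ x in Ω, q x * B.indicator 1 x ∂μ = ∫ x in B ∩ Ω, q x ∂μ := by
    simp only [← indicator_mul_right, Pi.one_apply, mul_one]
    rw [setIntegral_indicator hB, inter_comm]
  have hlim_sub := hlim.sub_const (∫ x in B ∩ Ω, w x ∂μ)
  simp only [hint, sub_self] at hlim_sub
  refine hlim_sub.congr fun n => ?_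
  rw [setIntegral_indicator hΩ,
    integral_sub ((hu n).mono_set inter_subset_right) (hw.mono_set inter_subset_right)]

lemma exists_subseq_tendsto_setLIntegral_enorm_sub (hΩ : IsOpen Ω) (hΩ_fin : volume Ω ≠ ⊤)
    {u : ℕ → Plane → ℝ} (hu : ∀ n, Measurable (u n)) {R : ℝ} (hR : ∀ n x, |u n x| ≤ R)
    (hC : ∀ n, TV Ω (u n) ≤ C) :
    ∃ (w : Plane → ℝ) (k : ℕ → ℕ), StrictMono k ∧ Measurable w ∧
      Tendsto (fun n => ∫⁻ x in Ω, ‖u (k n) x - w x‖ₑ) atTop (𝓝 0) := by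
  have : IsFiniteMeasure (volume.restrict Ω) := isFiniteMeasure_restrict.2 hΩ_fin
  obtain ⟨w, k, hk, hw, hw_memLp, hweak⟩ :=
    exists_subseq_tendsto_integral_mul (fun n => (hu n).aestronglyMeasurable) hR
      (μ := volume.restrict Ω)
  refine ⟨w, k, hk, hw, ?_⟩
  have hw_int : IntegrableOn w Ω := hw_memLp.integrable one_le_two
  have hu_int (n : ℕ) : IntegrableOn (u n) Ω :=
    Integrable.of_bound (hu n).aestronglyMeasurable R (Eventually.of_forall (hR n))
  have hw_TV : TV Ω w ≤ C := by
    refine (TV_le_liminf fun ξ hξ => hweak (div ξ) ?_).trans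
      (liminf_le_of_frequently_le' (Frequently.of_forall fun n => hC (k n)))
    exact ((continuous_div hξ.contDiff).memLp_of_hasCompactSupport
      (hasCompactSupport_div hξ.hasCompactSupport)).restrict Ω
  let v (n : ℕ) : Plane → ℝ := Ω.indicator fun x => u (k n) x - w x
  have hv (n : ℕ) : v n =ᵐ[volume.restrict Ω] fun x => u (k n) x - w x :=
    indicator_ae_eq_restrict hΩ.measurableSet
  have hv_TV (n : ℕ) : TV Ω (v n) ≤ (C + C : NNReal) := by
    rw [TV_congr_ae (hv n), ENNReal.coe_add]
    exact (TV_sub_le (hu_int _) hw_int).trans (add_le_add (hC _) hw_TV)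
  have hv_le (n : ℕ) (x : Plane) : |v n x| ≤ Ω.indicator (fun x => R + |w x|) x := by
    by_cases hx : x ∈ Ω
    · simp only [v, indicator_of_mem hx]
      exact (abs_sub _ _).trans (add_le_add_left (hR (k n) x) _)
    · simp [v, hx]
  have hv_ball (x : Plane) (r : ℝ) :
      Tendsto (fun n => ∫ y in Metric.ball x r, v n y) atTop (𝓝 0) := by
    have hmem : MemLp ((Metric.ball x r).indicator 1) 2 (volume.restrict Ω) :=
      memLp_indicator_const 2 measurableSet_ball (1 : ℝ) (Or.inr (measure_ne_top _ _))
    exact tendsto_setIntegral_indicator_sub hΩ.measurableSet measurableSet_ball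
      (fun n => hu_int (k n)) hw_int (hweak _ hmem)
  have hG : Integrable (Ω.indicator fun x => R + |w x|) :=
    (integrable_indicator_iff hΩ.measurableSet).2 ((integrable_const R).add hw_int.abs)
  refine (tendsto_setLIntegral_enorm_of_TV_le hΩ hΩ_fin hG (fun n => ?_) hv_le hv_TV
    hv_ball).congr fun n => ?_
  · exact (((hu _).sub hw).indicator hΩ.measurableSet).aestronglyMeasurable
  · exact lintegral_congr_ae ((hv n).mono fun x hx => congrArg enorm hx)

lemma exists_subseq_tendsto_ae_of_TV_le (hΩ : IsOpen Ω) (hΩ_fin : volume Ω ≠ ⊤)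
    {u : ℕ → Plane → ℝ} (hu : ∀ n, Measurable (u n)) (hu₁ : ∀ n x, u n x ∈ Icc (0 : ℝ) 1)
    (hC : ∀ n, TV Ω (u n) ≤ C) :
    ∃ (w : Plane → ℝ) (k : ℕ → ℕ), StrictMono k ∧ Measurable w ∧ (∀ x, w x ∈ Icc (0 : ℝ) 1) ∧
      ∀ᵐ x ∂(volume.restrict Ω), Tendsto (fun n => u (k n) x) atTop (𝓝 (w x)) := by
  obtain ⟨w, k, hk, hw, hlim⟩ := exists_subseq_tendsto_setLIntegral_enorm_sub hΩ hΩ_fin hu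
    (fun n x => abs_le.2 ⟨by linarith [(hu₁ n x).1], (hu₁ n x).2⟩) hC
  have hmeas : TendstoInMeasure (volume.restrict Ω) (fun n => u (k n)) atTop w := by
    refine tendstoInMeasure_of_tendsto_eLpNorm (p := 1) one_ne_zero
      (fun n => (hu (k n)).aestronglyMeasurable) hw.aestronglyMeasurable ?_
    simpa only [eLpNorm_one_eq_lintegral_enorm, Pi.sub_apply] using hlim
  obtain ⟨l, hl, hlim_ae⟩ := hmeas.exists_seq_tendsto_ae
  refine ⟨fun x => projIcc (0 : ℝ) 1 zero_le_one (w x), k ∘ l, hk.comp hl,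
    measurable_subtype_coe.comp (continuous_projIcc.measurable.comp hw),
    fun x => Subtype.coe_prop _, hlim_ae.mono fun x hx => ?_⟩
  have hwx : w x ∈ Icc (0 : ℝ) 1 :=
    isClosed_Icc.mem_of_tendsto hx (Eventually.of_forall fun n => hu₁ _ x)
  simpa only [projIcc_of_mem zero_le_one hwx, Function.comp_apply] using hx

end Compactness

section ExtIntegral

lemma coe_ennreal_sub_le_coe_ennreal_sub {p n p' n' : ENNReal} (hn : n ≠ ⊤) (hn' : n' ≠ ⊤)
    (h : p + n' ≤ p' + n) : (p : EReal) - n ≤ p' - n' := by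
  have hnn' : ((n : ENNReal) : EReal) ≠ ⊤ ∧ ((n' : ENNReal) : EReal) ≠ ⊤ := by simp [hn, hn']
  rw [EReal.le_sub_iff_add_le (Or.inl (EReal.coe_ennreal_ne_bot _)) (Or.inl hnn'.2),
    sub_eq_add_neg, add_right_comm, ← sub_eq_add_neg,
    EReal.sub_le_iff_le_add (Or.inl (EReal.coe_ennreal_ne_bot _)) (Or.inl hnn'.1)]
  exact_mod_cast h

variable {α β : Type*} [MeasurableSpace α] [MeasurableSpace β] {μ : Measure α} {f g : α → ℝ}

lemma extIntegral_eq_bot (hf : ∫⁻ x, ENNReal.ofReal (-f x) ∂μ = ⊤) : extIntegral μ f = ⊥ := by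
  rw [extIntegral, hf, EReal.coe_ennreal_top, EReal.sub_top]

lemma extIntegral_mono_ae (h : f ≤ᵐ[μ] g) : extIntegral μ f ≤ extIntegral μ g :=
  EReal.sub_le_sub
    (EReal.coe_ennreal_le_coe_ennreal_iff.2 <|
      lintegral_mono_ae <| h.mono fun _ hx => ENNReal.ofReal_le_ofReal hx)
    (EReal.coe_ennreal_le_coe_ennreal_iff.2 <|
      lintegral_mono_ae <| h.mono fun _ hx => ENNReal.ofReal_le_ofReal (neg_le_neg hx))

lemma extIntegral_of_nonneg (h : 0 ≤ᵐ[μ] f) :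
    extIntegral μ f = ((∫⁻ x, ENNReal.ofReal (f x) ∂μ : ENNReal) : EReal) := by
  have hneg : ∫⁻ x, ENNReal.ofReal (-f x) ∂μ = 0 := by
    rw [lintegral_congr_ae (h.mono fun x hx => ENNReal.ofReal_of_nonpos (neg_nonpos.2 hx)),
      lintegral_zero]
  rw [extIntegral, hneg, EReal.coe_ennreal_zero, sub_zero]

lemma extIntegral_eq_integral (hf : Integrable f μ) :
    extIntegral μ f = ((∫ x, f x ∂μ : ℝ) : EReal) := by
  rw [extIntegral, integral_eq_lintegral_pos_part_sub_lintegral_neg_part hf, EReal.coe_sub,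
    EReal.coe_ennreal_toReal hf.lintegral_lt_top.ne,
    EReal.coe_ennreal_toReal (show ∫⁻ x, ENNReal.ofReal (-f x) ∂μ ≠ ⊤ from
      hf.neg.lintegral_lt_top.ne)]

lemma extIntegral_map {F : α → β} (hF : AEMeasurable F μ) {f : β → ℝ}
    (hf : AEMeasurable f (μ.map F)) :
    extIntegral (μ.map F) f = extIntegral μ fun x => f (F x) := by
  rw [extIntegral, extIntegral, lintegral_map' hf.ennreal_ofReal hF,
    lintegral_map' (f := fun x => ENNReal.ofReal (-f x)) hf.neg.ennreal_ofReal hF]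

lemma ofReal_add_add_ofReal_neg_add_ofReal_neg (s t : ℝ) :
    ENNReal.ofReal s + ENNReal.ofReal t + ENNReal.ofReal (-(s + t))
      = ENNReal.ofReal (s + t) + (ENNReal.ofReal (-s) + ENNReal.ofReal (-t)) := by
  refine (ENNReal.toReal_eq_toReal_iff' (by simp) (by simp)).1 ?_
  simp only [ENNReal.toReal_add, ENNReal.add_ne_top, ne_eq, ENNReal.ofReal_ne_top,
    not_false_eq_true, and_self, ENNReal.toReal_ofReal']
  linarith [max_zero_sub_max_neg_zero_eq_self s, max_zero_sub_max_neg_zero_eq_self t,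
    max_zero_sub_max_neg_zero_eq_self (s + t)]

lemma extIntegral_add_le (hf : AEMeasurable f μ) (hg : AEMeasurable g μ) :
    extIntegral μ f + extIntegral μ g ≤ extIntegral μ fun x => f x + g x := by
  have hf_neg : AEMeasurable (fun x => ENNReal.ofReal (-f x)) μ := hf.neg.ennreal_ofReal
  by_cases hnf : ∫⁻ x, ENNReal.ofReal (-f x) ∂μ = ⊤
  · rw [extIntegral_eq_bot hnf, EReal.bot_add]
    exact bot_le
  by_cases hng : ∫⁻ x, ENNReal.ofReal (-g x) ∂μ = ⊤
  · rw [extIntegral_eq_bot hng, EReal.add_bot]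
    exact bot_le
  have hnfg : ∫⁻ x, ENNReal.ofReal (-(f x + g x)) ∂μ ≠ ⊤ := by
    refine ne_top_of_le_ne_top (ENNReal.add_ne_top.2 ⟨hnf, hng⟩) ?_
    rw [← lintegral_add_left' hf_neg]
    exact lintegral_mono fun x => by rw [neg_add]; exact ENNReal.ofReal_add_le
  have hsplit : (∫⁻ x, ENNReal.ofReal (f x) ∂μ) + (∫⁻ x, ENNReal.ofReal (g x) ∂μ)
        + ∫⁻ x, ENNReal.ofReal (-(f x + g x)) ∂μ
      = (∫⁻ x, ENNReal.ofReal (f x + g x) ∂μ)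
        + ((∫⁻ x, ENNReal.ofReal (-f x) ∂μ) + ∫⁻ x, ENNReal.ofReal (-g x) ∂μ) := by
    rw [← lintegral_add_left' hf.ennreal_ofReal, ← lintegral_add_left' hf_neg,
      ← lintegral_add_left' (f := fun x => ENNReal.ofReal (f x + g x)) (hf.add hg).ennreal_ofReal,
      ← lintegral_add_left' (f := fun x => ENNReal.ofReal (f x) + ENNReal.ofReal (g x))
        (hf.ennreal_ofReal.add hg.ennreal_ofReal)]
    exact lintegral_congr fun x => ofReal_add_add_ofReal_neg_add_ofReal_neg (f x) (g x)
  rw [extIntegral, extIntegral, ← EReal.add_sub_add_comm (Or.inl (EReal.coe_ennreal_ne_bot _))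
    (Or.inl (by simpa using hnf)), ← EReal.coe_ennreal_add, ← EReal.coe_ennreal_add]
  exact coe_ennreal_sub_le_coe_ennreal_sub (ENNReal.add_ne_top.2 ⟨hnf, hng⟩) hnfg hsplit.le

lemma extIntegral_eq_lintegral_sub_add (hf : AEMeasurable f μ) (hg : Integrable g μ)
    (hgf : g ≤ᵐ[μ] f) :
    extIntegral μ f = ((∫⁻ x, ENNReal.ofReal (f x - g x) ∂μ : ENNReal) : EReal)
      + ((∫ x, g x ∂μ : ℝ) : EReal) := by
  rw [← extIntegral_of_nonneg (f := fun x => f x - g x) (hgf.mono fun x hx => sub_nonneg.2 hx)]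
  refine le_antisymm ?_ ?_
  · have h := extIntegral_add_le hf hg.neg.aemeasurable
    rw [extIntegral_eq_integral hg.neg] at h
    simp only [Pi.neg_apply, integral_neg, EReal.coe_neg, ← sub_eq_add_neg] at h
    exact (EReal.sub_le_iff_le_add (Or.inl (EReal.coe_ne_bot _))
      (Or.inl (EReal.coe_ne_top _))).1 h
  · rw [← extIntegral_eq_integral hg]
    refine (extIntegral_add_le (hf.sub hg.aemeasurable) hg.aemeasurable).trans_eq ?_
    simp only [Pi.sub_apply, sub_add_cancel]

end ExtIntegral

section PositiveExtension

variable {Z : Type*} [TopologicalSpace Z]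

/-- The cone in `C(Z, ℝ) × ℝ` spanned by the minorants of `c` placed at height one, together with
the nonpositive functions at height zero. A functional that is nonnegative on it is, up to sign,
positive on `C(Z, ℝ)` and bounded above on the minorants of `c`. -/
def minorantCone (c : Z → ℝ) : PointedCone ℝ (C(Z, ℝ) × ℝ) where
  carrier := {q | 0 ≤ q.2 ∧ ∀ z, q.1 z ≤ q.2 * c z}
  add_mem' := fun {p q} hp hq => ⟨add_nonneg hp.1 hq.1, fun z =>
    (add_le_add (hp.2 z) (hq.2 z)).trans_eq (add_mul p.2 q.2 (c z)).symm⟩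
  zero_mem' := ⟨le_rfl, fun z => (zero_mul (c z)).ge⟩
  smul_mem' := fun r q hq => ⟨mul_nonneg r.2 hq.1, fun z =>
    (mul_le_mul_of_nonneg_left (hq.2 z) r.2).trans_eq (mul_assoc (r : ℝ) q.2 (c z)).symm⟩

lemma apply_le_of_mem_minorantCone {c : Z → ℝ} {V : Submodule ℝ C(Z, ℝ)} {ℓ : C(Z, ℝ) →ₗ[ℝ] ℝ}
    {K : ℝ} (hℓ : ∀ h ∈ V, 0 ≤ h → 0 ≤ ℓ h) (hK : ∀ h ∈ V, (∀ z, h z ≤ c z) → ℓ h ≤ K)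
    {q : C(Z, ℝ) × ℝ} (hqV : q.1 ∈ V) (hq : q ∈ minorantCone c) : ℓ q.1 ≤ q.2 * K := by
  obtain ⟨hq₀, hqc⟩ := hq
  rcases hq₀.eq_or_lt with h₀ | hpos
  · have h := hℓ (-q.1) (V.neg_mem hqV) fun z => neg_nonneg.2 <| by
      simpa only [← h₀, zero_mul] using hqc z
    rw [map_neg] at h
    rw [← h₀, zero_mul]
    linarith
  · have h := hK (q.2⁻¹ • q.1) (V.smul_mem _ hqV) fun z => (inv_mul_le_iff₀ hpos).2 (hqc z)
    rwa [map_smul, smul_eq_mul, inv_mul_le_iff₀ hpos] at h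

lemma exists_positive_extension_le [CompactSpace Z] {c : Z → ℝ} {V : Submodule ℝ C(Z, ℝ)}
    (hV : (1 : C(Z, ℝ)) ∈ V) {ℓ : C(Z, ℝ) →ₗ[ℝ] ℝ} {K : ℝ} (hℓ : ∀ h ∈ V, 0 ≤ h → 0 ≤ ℓ h)
    (hK : ∀ h ∈ V, (∀ z, h z ≤ c z) → ℓ h ≤ K) :
    ∃ L : C(Z, ℝ) →ₗ[ℝ] ℝ, (∀ h, 0 ≤ h → 0 ≤ L h) ∧ (∀ h ∈ V, L h = ℓ h) ∧
      ∀ h : C(Z, ℝ), (∀ z, h z ≤ c z) → L h ≤ K := by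
  let F : C(Z, ℝ) × ℝ →ₗ[ℝ] ℝ := K • LinearMap.snd ℝ _ ℝ - ℓ ∘ₗ LinearMap.fst ℝ _ ℝ
  have hF : ∀ h t, F (h, t) = t * K - ℓ h := fun h t => by simp [F, mul_comm]
  have hnonneg : ∀ q : V.prod (⊤ : Submodule ℝ ℝ), (q : C(Z, ℝ) × ℝ) ∈ minorantCone c →
      0 ≤ F.domRestrict _ q := fun q hq => by
    rw [LinearMap.domRestrict_apply, hF]
    exact sub_nonneg.2 (apply_le_of_mem_minorantCone hℓ hK q.2.1 hq)
  have hdense : ∀ q, ∃ p : V.prod (⊤ : Submodule ℝ ℝ), (p : C(Z, ℝ) × ℝ) + q ∈ minorantCone c := by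
    rintro ⟨h, t⟩
    refine ⟨⟨(-‖h‖ • 1, -t), V.smul_mem _ hV, trivial⟩, (neg_add_cancel t).ge, fun z => ?_⟩
    have := (Real.le_norm_self _).trans (h.norm_coe_le_norm z)
    simpa using this
  obtain ⟨G, hGF, hG⟩ := riesz_extension (minorantCone c) ⟨_, F.domRestrict _⟩ hnonneg hdense
  have hG_of_mem : ∀ h ∈ V, ∀ t : ℝ, G (h, t) = t * K - ℓ h := fun h hh t =>
    (hGF ⟨(h, t), hh, trivial⟩).trans (hF h t)
  refine ⟨-(G ∘ₗ LinearMap.inl ℝ _ ℝ), fun h hh => ?_, fun h hh => ?_, fun h hh => ?_⟩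
  · have hmem : (-h, (0 : ℝ)) ∈ minorantCone c :=
      ⟨le_rfl, fun z => by simpa using hh z⟩
    have : 0 ≤ G (-(h, 0)) := by simpa using hG _ hmem
    rwa [map_neg] at this
  · simp [hG_of_mem h hh]
  · have hmem : (h, (1 : ℝ)) ∈ minorantCone c := ⟨zero_le_one, fun z => by simpa using hh z⟩
    have h_add : G (h, 1) = G (h, 0) + K := by
      rw [show (h, (1 : ℝ)) = (h, 0) + (0, 1) by simp, map_add, hG_of_mem 0 V.zero_mem, one_mul,
        map_zero, sub_zero]
    have : -G (h, 0) ≤ K := by linarith [hG _ hmem]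
    simpa using this

end PositiveExtension

section Kantorovich

variable {X Y : Type*} [TopologicalSpace X] [TopologicalSpace Y]

/-- The linear map sending `(u, v)` to the separated function `(x, y) ↦ u x + v y`. -/
def separatedSum (X Y : Type*) [TopologicalSpace X] [TopologicalSpace Y] :
    C(X, ℝ) × C(Y, ℝ) →ₗ[ℝ] C(X × Y, ℝ) :=
  (ContinuousMap.compRightAlgHom ℝ ℝ .fst).toLinearMap.coprod
    (ContinuousMap.compRightAlgHom ℝ ℝ .snd).toLinearMap

lemma separatedSum_apply (u : C(X, ℝ)) (v : C(Y, ℝ)) (z : X × Y) :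
    separatedSum X Y (u, v) z = u z.1 + v z.2 := rfl

lemma one_mem_range_separatedSum : (1 : C(X × Y, ℝ)) ∈ (separatedSum X Y).range :=
  ⟨(1, 0), ContinuousMap.ext fun _ => add_zero 1⟩

lemma integrable_continuousMap {X : Type*} [TopologicalSpace X] [CompactSpace X]
    [MeasurableSpace X] [OpensMeasurableSpace X] (μ : Measure X) [IsFiniteMeasure μ]
    (h : C(X, ℝ)) : Integrable (fun x => h x) μ :=
  h.continuous.integrable_of_hasCompactSupport (HasCompactSupport.of_compactSpace _)

/-- Integration against a finite measure, as a linear functional on continuous functions. -/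
noncomputable def integralLinearMap {X : Type*} [TopologicalSpace X] [CompactSpace X]
    [MeasurableSpace X] [OpensMeasurableSpace X] (μ : Measure X) [IsFiniteMeasure μ] :
    C(X, ℝ) →ₗ[ℝ] ℝ where
  toFun h := ∫ x, h x ∂μ
  map_add' h k := integral_add (integrable_continuousMap μ h) (integrable_continuousMap μ k)
  map_smul' r h := integral_const_mul r fun x => h x

lemma exists_measure_integral_eq {Z : Type*} [TopologicalSpace Z] [CompactSpace Z] [T2Space Z]
    [MeasurableSpace Z] [BorelSpace Z] {L : C(Z, ℝ) →ₗ[ℝ] ℝ} (hL : ∀ h, 0 ≤ h → 0 ≤ L h) :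
    ∃ π : Measure Z, IsFiniteMeasure π ∧ ∀ h : C(Z, ℝ), ∫ z, h z ∂π = L h := by
  let Λ : C_c(Z, ℝ) →ₚ[ℝ] ℝ := PositiveLinearMap.mk₀
    { toFun := fun h => L h.toContinuousMap
      map_add' := fun h k => L.map_add h.toContinuousMap k.toContinuousMap
      map_smul' := fun r h => L.map_smul r h.toContinuousMap } fun h hh => hL _ hh
  exact ⟨RealRMK.rieszMeasure Λ, inferInstance, fun h =>
    RealRMK.integral_rieszMeasure Λ ⟨h, HasCompactSupport.of_compactSpace _⟩⟩

lemma map_eq_of_forall_integral_comp_eq {Z W : Type*} [TopologicalSpace Z] [MeasurableSpace Z]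
    [OpensMeasurableSpace Z] [TopologicalSpace W] [HasOuterApproxClosed W] [MeasurableSpace W]
    [BorelSpace W] {π : Measure Z} [IsFiniteMeasure π] {μ : Measure W} [IsFiniteMeasure μ]
    (F : C(Z, W)) (h : ∀ u : C(W, ℝ), ∫ z, u (F z) ∂π = ∫ w, u w ∂μ) : π.map F = μ := by
  have : IsFiniteMeasure (π.map F) := Measure.isFiniteMeasure_map _ _
  refine ext_of_forall_integral_eq_of_IsFiniteMeasure fun u => ?_
  rw [integral_map F.continuous.measurable.aemeasurable u.continuous.aestronglyMeasurable]
  exact h u.toContinuousMap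

variable [CompactSpace X] [MeasurableSpace X] [CompactSpace Y] [MeasurableSpace Y]

lemma integral_separatedSum [OpensMeasurableSpace X] [OpensMeasurableSpace Y] (μ : Measure X)
    [IsProbabilityMeasure μ] (ν : Measure Y) [IsProbabilityMeasure ν] (u : C(X, ℝ)) (v : C(Y, ℝ)) :
    ∫ z, separatedSum X Y (u, v) z ∂(μ.prod ν) = ∫ x, u x ∂μ + ∫ y, v y ∂ν := by
  simp only [separatedSum_apply]
  rw [integral_add ((integrable_continuousMap μ u).comp_fst ν)
    ((integrable_continuousMap ν v).comp_snd μ), integral_fun_fst (fun x => u x),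
    integral_fun_snd (fun y => v y), probReal_univ, probReal_univ, one_smul, one_smul]

lemma exists_coupling_integral_le {X Y : Type*} [MetricSpace X] [CompactSpace X]
    [MeasurableSpace X] [BorelSpace X] [MetricSpace Y] [CompactSpace Y] [MeasurableSpace Y]
    [BorelSpace Y] (μ : Measure X) [IsProbabilityMeasure μ] (ν : Measure Y)
    [IsProbabilityMeasure ν] {c : X × Y → ℝ} {K : ℝ}
    (hK : ∀ (u : C(X, ℝ)) (v : C(Y, ℝ)), (∀ x y, u x + v y ≤ c (x, y)) →
      ∫ x, u x ∂μ + ∫ y, v y ∂ν ≤ K) :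
    ∃ π : Measure (X × Y), π.map Prod.fst = μ ∧ π.map Prod.snd = ν ∧
      ∀ h : C(X × Y, ℝ), (∀ z, h z ≤ c z) → ∫ z, h z ∂π ≤ K := by
  obtain ⟨L, hL, hL_sum, hL_le⟩ := exists_positive_extension_le (c := c) (K := K)
    (ℓ := integralLinearMap (μ.prod ν)) one_mem_range_separatedSum
    (fun h _ hh => integral_nonneg hh) (by
      rintro _ ⟨⟨u, v⟩, rfl⟩ huv
      exact (integral_separatedSum μ ν u v).trans_le (hK u v fun x y => huv (x, y)))
  obtain ⟨π, hπ, hπL⟩ := exists_measure_integral_eq hL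
  have hsum : ∀ (u : C(X, ℝ)) (v : C(Y, ℝ)),
      ∫ z : X × Y, u z.1 + v z.2 ∂π = ∫ x, u x ∂μ + ∫ y, v y ∂ν := fun u v =>
    ((hπL _).trans (hL_sum _ ⟨(u, v), rfl⟩)).trans (integral_separatedSum μ ν u v)
  refine ⟨π, map_eq_of_forall_integral_comp_eq .fst fun u => ?_,
    map_eq_of_forall_integral_comp_eq .snd fun v => ?_, fun h hh => (hπL h).trans_le (hL_le h hh)⟩
  · simpa using hsum u 0
  · simpa using hsum 0 v

section InfConvolution

variable {Z : Type*} [PseudoMetricSpace Z] {c : Z → ℝ} {m : ℝ}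

/-- The largest `k`-Lipschitz minorant of `c`, for `c` bounded below. -/
noncomputable def lipschitzMinorant (c : Z → ℝ) (k : ℕ) (z : Z) : ℝ := ⨅ w, (c w + k * dist z w)

lemma le_add_mul_dist (hm : ∀ z, m ≤ c z) (k : ℕ) (z w : Z) : m ≤ c w + k * dist z w :=
  (hm w).trans (le_add_of_nonneg_right (by positivity))

lemma bddBelow_range_add_mul_dist (hm : ∀ z, m ≤ c z) (k : ℕ) (z : Z) :
    BddBelow (range fun w => c w + k * dist z w) :=
  ⟨m, forall_mem_range.2 (le_add_mul_dist hm k z)⟩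

lemma le_lipschitzMinorant (hm : ∀ z, m ≤ c z) (k : ℕ) (z : Z) : m ≤ lipschitzMinorant c k z :=
  haveI : Nonempty Z := ⟨z⟩
  le_ciInf (le_add_mul_dist hm k z)

lemma lipschitzMinorant_le (hm : ∀ z, m ≤ c z) (k : ℕ) (z : Z) : lipschitzMinorant c k z ≤ c z :=
  (ciInf_le (bddBelow_range_add_mul_dist hm k z) z).trans_eq (by rw [dist_self, mul_zero, add_zero])

lemma lipschitzWith_lipschitzMinorant (hm : ∀ z, m ≤ c z) (k : ℕ) :
    LipschitzWith k (lipschitzMinorant c k) := by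
  refine LipschitzWith.of_le_add_mul _ fun z z' => ?_
  have : Nonempty Z := ⟨z⟩
  rw [← sub_le_iff_le_add]
  refine le_ciInf fun w => sub_le_iff_le_add.2 <|
    (ciInf_le (bddBelow_range_add_mul_dist hm k z) w).trans ?_
  have h := mul_le_mul_of_nonneg_left (dist_triangle z z' w) (Nat.cast_nonneg (α := ℝ) k)
  rw [NNReal.coe_natCast]
  linarith

lemma tendsto_lipschitzMinorant (hm : ∀ z, m ≤ c z) {z : Z} (hc : LowerSemicontinuousAt c z) :
    Tendsto (fun k => lipschitzMinorant c k z) atTop (𝓝 (c z)) := by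
  refine tendsto_order.2 ⟨fun a ha => ?_, fun a ha =>
    Eventually.of_forall fun k => (lipschitzMinorant_le hm k z).trans_lt ha⟩
  obtain ⟨a', haa', ha'⟩ := exists_between ha
  obtain ⟨ε, hε, hball⟩ := Metric.eventually_nhds_iff.1 (hc a' ha')
  obtain ⟨N, hN⟩ := exists_nat_gt ((a' - m) / ε)
  filter_upwards [eventually_ge_atTop N] with k hk
  have : Nonempty Z := ⟨z⟩
  refine haa'.trans_le (le_ciInf fun w => ?_)
  rcases lt_or_ge (dist w z) ε with hw | hw
  · exact (hball hw).le.trans (le_add_of_nonneg_right (by positivity))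
  · have hfar : (N : ℝ) * ε ≤ k * dist z w := by
      rw [dist_comm z w]
      exact mul_le_mul (by exact_mod_cast hk) hw hε.le (by positivity)
    linarith [hm w, (div_lt_iff₀ hε).1 hN]

end InfConvolution

lemma extIntegral_le_of_forall_continuous_le {Z : Type*} [PseudoMetricSpace Z] [MeasurableSpace Z]
    [BorelSpace Z] [CompactSpace Z] {π : Measure Z} [IsProbabilityMeasure π] {c : Z → ℝ}
    (hc : LowerSemicontinuous c) {K : ℝ}
    (hK : ∀ h : C(Z, ℝ), (∀ z, h z ≤ c z) → ∫ z, h z ∂π ≤ K) : extIntegral π c ≤ K := by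
  obtain ⟨z₀, -, hz₀⟩ := (lowerSemicontinuousOn_univ_iff.2 hc).exists_isMinOn
    (nonempty_iff_univ_nonempty.1 π.nonempty_of_neZero) isCompact_univ
  have hm : ∀ z, c z₀ ≤ c z := fun z => hz₀ (mem_univ z)
  set m := c z₀
  have hmK : m ≤ K := by simpa using hK (.const Z m) hm
  let d : ℕ → C(Z, ℝ) := fun k =>
    ⟨lipschitzMinorant c k, (lipschitzWith_lipschitzMinorant hm k).continuous⟩
  have hd : ∀ k, ∫⁻ z, ENNReal.ofReal (d k z - m) ∂π ≤ ENNReal.ofReal (K - m) := fun k => by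
    have hsub : Integrable (fun z => d k z - m) π :=
      (integrable_continuousMap π (d k)).sub (integrable_const m)
    rw [← ofReal_integral_eq_lintegral_ofReal hsub
      (Eventually.of_forall fun z => sub_nonneg.2 (le_lipschitzMinorant hm k z)),
      integral_sub (integrable_continuousMap π (d k)) (integrable_const m), integral_const,
      probReal_univ, one_smul]
    exact ENNReal.ofReal_le_ofReal (sub_le_sub_right (hK (d k) (lipschitzMinorant_le hm k)) m)
  have hlint : ∫⁻ z, ENNReal.ofReal (c z - m) ∂π ≤ ENNReal.ofReal (K - m) :=
    (lintegral_mono fun z => (ENNReal.tendsto_ofReal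
      ((tendsto_lipschitzMinorant hm (hc z)).sub_const m)).liminf_eq.ge).trans <|
    (lintegral_liminf_le fun k =>
      ((d k).continuous.measurable.sub_const m).ennreal_ofReal).trans <|
    (liminf_le_liminf (Eventually.of_forall hd)).trans_eq (liminf_const _)
  rw [extIntegral_eq_lintegral_sub_add hc.measurable.aemeasurable (integrable_const m)
    (Eventually.of_forall hm), integral_const, probReal_univ, one_smul]
  calc ((∫⁻ z, ENNReal.ofReal (c z - m) ∂π : ENNReal) : EReal) + (m : EReal)
      ≤ (ENNReal.ofReal (K - m) : EReal) + (m : EReal) :=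
        add_le_add_left (EReal.coe_ennreal_le_coe_ennreal_iff.2 hlint) _
    _ = K := by
        rw [EReal.coe_ennreal_ofReal, max_eq_left (sub_nonneg.2 hmK), ← EReal.coe_add,
          sub_add_cancel]

/-- The measurable potentials are tested against a coupling which is optimal for the continuous dual
problem. -/
lemma extIntegral_add_le_of_forall_continuous {X Y : Type*} [MetricSpace X] [CompactSpace X]
    [MeasurableSpace X] [BorelSpace X] [MetricSpace Y] [CompactSpace Y] [MeasurableSpace Y]
    [BorelSpace Y] {μ : Measure X} [IsProbabilityMeasure μ] {ν : Measure Y}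
    [IsProbabilityMeasure ν] {c : X × Y → ℝ} (hc : LowerSemicontinuous c) {K : ℝ}
    (hK : ∀ (u : C(X, ℝ)) (v : C(Y, ℝ)), (∀ x y, u x + v y ≤ c (x, y)) →
      ∫ x, u x ∂μ + ∫ y, v y ∂ν ≤ K)
    {a : X → ℝ} {b : Y → ℝ} (ha : Measurable a) (hb : Measurable b)
    (hab : ∀ x y, a x + b y ≤ c (x, y)) : extIntegral μ a + extIntegral ν b ≤ K := by
  obtain ⟨π, rfl, rfl, hπ⟩ := exists_coupling_integral_le μ ν hK
  have : IsProbabilityMeasure π := Measure.isProbabilityMeasure_of_map Prod.fst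
  rw [extIntegral_map measurable_fst.aemeasurable ha.aemeasurable,
    extIntegral_map measurable_snd.aemeasurable hb.aemeasurable]
  exact (extIntegral_add_le (ha.comp measurable_fst).aemeasurable
    (hb.comp measurable_snd).aemeasurable).trans <|
      (extIntegral_mono_ae (Eventually.of_forall fun z : X × Y => hab z.1 z.2)).trans
        (extIntegral_le_of_forall_continuous_le hc hπ)

end Kantorovich

section Coarea

variable {Ω : Set Plane} {u : Plane → ℝ}

lemma lintegral_TV_congr_ae {φ φ' : Plane × ℝ → ℝ}
    (h : φ =ᵐ[volume.restrict (Ω ×ˢ (univ : Set ℝ))] φ') (s : Set ℝ) :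
    ∫⁻ γ in s, TV Ω (fun x => φ (x, γ)) = ∫⁻ γ in s, TV Ω (fun x => φ' (x, γ)) := by
  rw [Measure.volume_eq_prod, ← Measure.prod_restrict, Measure.restrict_univ,
    ← Measure.prod_swap] at h
  have hswap := Measure.ae_ae_of_ae_prod (ae_of_ae_map measurable_swap.aemeasurable h)
  exact lintegral_congr_ae (ae_restrict_of_ae (hswap.mono fun γ hγ => TV_congr_ae hγ))

lemma exists_countable_biSup_eq {X ι : Type*} [TopologicalSpace X] [SecondCountableTopology X]
    {S : Set ι} {F : ι → X → ENNReal} (hF : ∀ i ∈ S, LowerSemicontinuous (F i)) :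
    ∃ T ⊆ S, T.Countable ∧ ∀ x, ⨆ i ∈ T, F i x = ⨆ i ∈ S, F i x := by
  obtain ⟨𝓕, h𝓕_sub, h𝓕_count, h𝓕_lub⟩ :=
    exists_countable_lowerSemicontinuous_isLUB (forall_mem_image.2 hF) (isLUB_sSup (F '' S))
  obtain ⟨T, hTS, hT⟩ := SurjOn.exists_bijOn_subset h𝓕_sub
  refine ⟨T, hTS, countable_of_injective_of_countable_image hT.injOn (hT.image_eq ▸ h𝓕_count), ?_⟩
  have hsup : ⨆ i ∈ T, F i = ⨆ i ∈ S, F i := by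
    rw [← sSup_image, ← sSup_image, hT.image_eq, h𝓕_lub.sSup_eq]
  intro x
  simpa only [iSup_apply] using congrFun hsup x

lemma IsTest.continuous_setIntegral_mul_div {ξ : Plane → Plane} (hξ : IsTest Ω ξ) :
    Continuous fun v : Lp ℝ 2 (volume.restrict Ω) => ∫ x in Ω, v x * div ξ x := by
  have hdiv : MemLp (div ξ) 2 (volume.restrict Ω) :=
    ((continuous_div hξ.contDiff).memLp_of_hasCompactSupport
      (hasCompactSupport_div hξ.hasCompactSupport)).restrict Ω
  have hinner (v : Lp ℝ 2 (volume.restrict Ω)) :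
      ∫ x in Ω, v x * div ξ x = inner ℝ (hdiv.toLp (div ξ)) v := by
    rw [L2.inner_def]
    refine integral_congr_ae ?_
    filter_upwards [hdiv.coeFn_toLp] with x hx
    rw [hx, RCLike.inner_apply, conj_trivial]
  simp only [hinner]
  fun_prop

lemma exists_countable_TV_eq_biSup (Ω : Set Plane) :
    ∃ T : Set (Plane → Plane), T.Countable ∧ (∀ ξ ∈ T, IsTest Ω ξ) ∧
      ∀ v, MemLp v 2 (volume.restrict Ω) →
        TV Ω v = ⨆ ξ ∈ T, ENNReal.ofReal (∫ x in Ω, v x * div ξ x) := by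
  have : Fact ((2 : ENNReal) ≠ ⊤) := ⟨ENNReal.ofNat_ne_top⟩
  obtain ⟨T, hTS, hT_count, hT⟩ := exists_countable_biSup_eq
    (S := {ξ : Plane → Plane | IsTest Ω ξ ∧ ∀ x, ‖ξ x‖ ≤ 1})
    (F := fun ξ (v : Lp ℝ 2 (volume.restrict Ω)) => ENNReal.ofReal (∫ x in Ω, v x * div ξ x))
    fun ξ hξ => (ENNReal.continuous_ofReal.comp
      hξ.1.continuous_setIntegral_mul_div).lowerSemicontinuous
  refine ⟨T, hT_count, fun ξ hξ => (hTS hξ).1, fun v hv => ?_⟩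
  have hint (ξ : Plane → Plane) : ∫ x in Ω, hv.toLp v x * div ξ x = ∫ x in Ω, v x * div ξ x :=
    integral_congr_ae (hv.coeFn_toLp.mono fun x hx => congrArg (· * div ξ x) hx)
  have hTv := hT (hv.toLp v)
  simp only [hint] at hTv
  rw [hTv]
  simp only [TV, mem_ofPred_eq, iSup_and]

lemma measurable_TV_slice {Y : Type*} [MeasurableSpace Y] {v : Plane × Y → ℝ} (hv : Measurable v)
    (hv₂ : ∀ y, MemLp (fun x => v (x, y)) 2 (volume.restrict Ω)) :
    Measurable fun y => TV Ω fun x => v (x, y) := by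
  obtain ⟨T, hT_count, hT_test, hT⟩ := exists_countable_TV_eq_biSup Ω
  simp only [fun y => hT _ (hv₂ y)]
  refine Measurable.biSup _ hT_count fun ξ hξ => Measurable.ennreal_ofReal ?_
  have hprod : Measurable fun p : Plane × Y => v p * div ξ p.1 :=
    hv.mul ((continuous_div (hT_test ξ hξ).contDiff).measurable.comp measurable_fst)
  exact hprod.stronglyMeasurable.integral_prod_left'.measurable

lemma measurable_TV_subgraphFn (hΩ_fin : volume Ω ≠ ⊤) (hu : Measurable u) :
    Measurable fun γ => TV Ω fun x => subgraphFn u (x, γ) := by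
  have : IsFiniteMeasure (volume.restrict Ω) := isFiniteMeasure_restrict.2 hΩ_fin
  exact measurable_TV_slice (measurable_subgraphFn hu) fun γ =>
    MemLp.of_bound ((measurable_subgraphFn hu).comp measurable_prodMk_right).aestronglyMeasurable 1
      (Eventually.of_forall fun x => abs_subgraphFn_le_one u _)

lemma integral_subgraphFn {X : Type*} {u : X → ℝ} {x : X} (hx : u x ∈ Icc (0 : ℝ) 1) :
    ∫ γ in Icc (0 : ℝ) 1, subgraphFn u (x, γ) = u x := by
  have hslice : (fun γ => subgraphFn u (x, γ)) = (Iio (u x)).indicator fun _ => (1 : ℝ) := rfl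
  have hinter : Icc (0 : ℝ) 1 ∩ Iio (u x) = Ico 0 (u x) := by
    rw [inter_comm, ← Iic_inter_Ici, ← inter_assoc, inter_eq_self_of_subset_left
      (Iio_subset_Iic hx.2), Iio_inter_Ici]
  rw [hslice, setIntegral_indicator measurableSet_Iio, hinter, setIntegral_const]
  simp [hx.1]

lemma TV_le_coareaIntegral (hu : Measurable u) (hu₁ : ∀ x, u x ∈ Icc (0 : ℝ) 1) :
    TV Ω u ≤ coareaIntegral Ω u := by
  refine TV_le_iff.2 fun ξ hξ hξ₁ => ?_
  have hint : Integrable (fun p : Plane × ℝ => subgraphFn u p * div ξ p.1)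
      ((volume.restrict Ω).prod (volume.restrict (Icc (0 : ℝ) 1))) :=
    (hξ.integrable_div.restrict.comp_fst _).bdd_mul (measurable_subgraphFn hu).aestronglyMeasurable
      (Eventually.of_forall (abs_subgraphFn_le_one u))
  calc ENNReal.ofReal (∫ x in Ω, u x * div ξ x)
      = ENNReal.ofReal (∫ γ in Icc (0 : ℝ) 1, ∫ x in Ω, subgraphFn u (x, γ) * div ξ x) := by
        rw [← integral_integral_swap hint]
        simp only [integral_mul_const, integral_subgraphFn (hu₁ _)]
    _ ≤ ∫⁻ γ in Icc (0 : ℝ) 1, ENNReal.ofReal (∫ x in Ω, subgraphFn u (x, γ) * div ξ x) :=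
        ofReal_integral_le_lintegral hint.integral_prod_right
    _ ≤ coareaIntegral Ω u :=
        lintegral_mono fun γ => ofReal_setIntegral_mul_div_le_TV hξ hξ₁

lemma ae_ae_ne {X : Type*} [MeasurableSpace X] {μ : Measure X} [SFinite μ] {w : X → ℝ}
    (hw : Measurable w) : ∀ᵐ γ : ℝ, ∀ᵐ x ∂μ, w x ≠ γ := by
  have hcount := Measure.countable_meas_level_set_pos (μ := μ) hw
  filter_upwards [hcount.ae_notMem volume] with γ hγ
  rw [ae_iff]
  simpa using hγ

lemma tendsto_subgraphFn {X : Type*} {v : ℕ → X → ℝ} {w : X → ℝ} {x : X} {γ : ℝ}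
    (hlim : Tendsto (fun n => v n x) atTop (𝓝 (w x))) (hγ : w x ≠ γ) :
    Tendsto (fun n => subgraphFn (v n) (x, γ)) atTop (𝓝 (subgraphFn w (x, γ))) := by
  refine tendsto_const_nhds.congr' ?_
  rcases lt_or_gt_of_ne hγ with h | h
  · filter_upwards [hlim.eventually_lt_const h] with n hn
    rw [subgraphFn_of_le h.le, subgraphFn_of_le hn.le]
  · filter_upwards [hlim.eventually_const_lt h] with n hn
    rw [subgraphFn_of_lt h, subgraphFn_of_lt hn]

variable {v : ℕ → Plane → ℝ} {w : Plane → ℝ}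

lemma TV_subgraphFn_le_liminf (hv : ∀ n, Measurable (v n))
    (hlim : ∀ᵐ x ∂volume.restrict Ω, Tendsto (fun n => v n x) atTop (𝓝 (w x)))
    {γ : ℝ} (hγ : ∀ᵐ x ∂volume.restrict Ω, w x ≠ γ) :
    TV Ω (fun x => subgraphFn w (x, γ))
      ≤ liminf (fun n => TV Ω fun x => subgraphFn (v n) (x, γ)) atTop := by
  refine TV_le_liminf fun ξ hξ => ?_
  refine tendsto_integral_of_dominated_convergence (fun x => |div ξ x|) (fun n => ?_)
    hξ.integrable_div.abs.restrict (fun n => Eventually.of_forall fun x => ?_) ?_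
  · exact (((measurable_subgraphFn (hv n)).comp measurable_prodMk_right).mul
      (continuous_div hξ.contDiff).measurable).aestronglyMeasurable
  · rw [norm_mul]
    exact mul_le_of_le_one_left (abs_nonneg _) (abs_subgraphFn_le_one _ _)
  · filter_upwards [hlim, hγ] with x hx hne
    exact (tendsto_subgraphFn hx hne).mul_const _

lemma coareaIntegral_le_liminf (hΩ_fin : volume Ω ≠ ⊤) (hv : ∀ n, Measurable (v n))
    (hw : Measurable w)
    (hlim : ∀ᵐ x ∂volume.restrict Ω, Tendsto (fun n => v n x) atTop (𝓝 (w x))) :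
    coareaIntegral Ω w ≤ liminf (fun n => coareaIntegral Ω (v n)) atTop :=
  (lintegral_mono_ae (ae_restrict_of_ae ((ae_ae_ne hw).mono fun _ hγ =>
    TV_subgraphFn_le_liminf hv hlim hγ))).trans
    (lintegral_liminf_le fun n => measurable_TV_subgraphFn hΩ_fin (hv n))

end Coarea

section DualPotentials

lemma exists_map_subtypeVal_eq {α : Type*} [MeasurableSpace α] {μ : Measure α} {s : Set α}
    (hs : MeasurableSet s) (hμ : μ sᶜ = 0) : ∃ μ' : Measure s, μ'.map (↑) = μ :=
  ⟨μ.comap (↑), by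
    rw [map_comap_subtype_coe hs, Measure.restrict_eq_self_of_ae_mem (mem_ae_iff.2 hμ)]⟩

variable {c : ℝ → ℝ → ℝ}

/-- The pairs of continuous functions on `ℝ` that satisfy the constraint of `dualSet c`. They
suffice to compute the supremum over `dualSet c`, and they make the transport term of the energy
continuous under a.e. convergence. -/
def continuousDualSet (c : ℝ → ℝ → ℝ) : Set ((ℝ → ℝ) × (ℝ → ℝ)) :=
  {p | Continuous p.1 ∧ Continuous p.2 ∧
    ∀ γ₁ ∈ Icc (0 : ℝ) 1, ∀ γ₂ ∈ Icc (0 : ℝ) 1, p.1 γ₁ - p.2 γ₂ ≤ c γ₁ γ₂}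

lemma continuousDualSet_subset_dualSet : continuousDualSet c ⊆ dualSet c :=
  fun _ ⟨hψ, hψ', hle⟩ =>
    ⟨hψ.measurable, hψ'.measurable, hψ.integrableOn_Icc, hψ'.integrableOn_Icc, hle⟩

lemma exists_const_mem_continuousDualSet
    (hc : LowerSemicontinuousOn (fun q : ℝ × ℝ => c q.1 q.2) (Icc (0 : ℝ) 1 ×ˢ Icc (0 : ℝ) 1)) :
    ∃ m : ℝ, (fun _ => m, fun _ => 0) ∈ continuousDualSet c := by
  obtain ⟨z, -, hz⟩ := hc.exists_isMinOn ⟨(0, 0), by simp⟩ (isCompact_Icc.prod isCompact_Icc)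
  exact ⟨c z.1 z.2, continuous_const, continuous_const, fun γ₁ h₁ γ₂ h₂ =>
    (sub_zero _).trans_le (hz (mk_mem_prod h₁ h₂))⟩

lemma extIntegral_add_le_of_mem_dualSet
    (hc : LowerSemicontinuousOn (fun q : ℝ × ℝ => c q.1 q.2) (Icc (0 : ℝ) 1 ×ˢ Icc (0 : ℝ) 1))
    {μ ν : Measure ℝ} [IsProbabilityMeasure μ] [IsProbabilityMeasure ν]
    (hμ : μ (Icc (0 : ℝ) 1)ᶜ = 0) (hν : ν (Icc (0 : ℝ) 1)ᶜ = 0) {K : ℝ}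
    (hK : ∀ p ∈ continuousDualSet c, ∫ t, p.1 t ∂μ - ∫ t, p.2 t ∂ν ≤ K)
    {p : (ℝ → ℝ) × (ℝ → ℝ)} (hp : p ∈ dualSet c) :
    extIntegral μ p.1 + extIntegral ν (fun t => -p.2 t) ≤ K := by
  obtain ⟨μ, rfl⟩ := exists_map_subtypeVal_eq measurableSet_Icc hμ
  obtain ⟨ν, rfl⟩ := exists_map_subtypeVal_eq measurableSet_Icc hν
  have := Measure.isProbabilityMeasure_of_map (μ := μ) ((↑) : Icc (0 : ℝ) 1 → ℝ)
  have := Measure.isProbabilityMeasure_of_map (μ := ν) ((↑) : Icc (0 : ℝ) 1 → ℝ)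
  obtain ⟨hψ, hψ', -, -, hle⟩ := hp
  have hψ'_neg : Measurable fun t => -p.2 t := hψ'.neg
  rw [extIntegral_map measurable_subtype_coe.aemeasurable hψ.aemeasurable,
    extIntegral_map measurable_subtype_coe.aemeasurable hψ'_neg.aemeasurable]
  have hc_sub : LowerSemicontinuous fun z : Icc (0 : ℝ) 1 × Icc (0 : ℝ) 1 => c z.1 z.2 :=
    lowerSemicontinuousOn_univ_iff.1 <|
      hc.comp (g := fun z : Icc (0 : ℝ) 1 × Icc (0 : ℝ) 1 => ((z.1 : ℝ), (z.2 : ℝ)))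
        (by fun_prop) fun z _ => ⟨z.1.2, z.2.2⟩
  refine extIntegral_add_le_of_forall_continuous hc_sub (fun u v huv => ?_)
    (hψ.comp measurable_subtype_coe) (hψ'_neg.comp measurable_subtype_coe)
    fun x y => (sub_eq_add_neg _ _).symm.trans_le (hle x x.2 y y.2)
  let U : ℝ → ℝ := fun t => u (projIcc 0 1 zero_le_one t)
  let V : ℝ → ℝ := fun t => -v (projIcc 0 1 zero_le_one t)
  have hU : Continuous U := u.continuous.comp continuous_projIcc
  have hV : Continuous V := (v.continuous.comp continuous_projIcc).neg
  have hUV := hK (U, V) ⟨hU, hV, fun s hs t ht => by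
    simpa only [U, V, projIcc_of_mem zero_le_one hs, projIcc_of_mem zero_le_one ht,
      sub_neg_eq_add] using huv ⟨s, hs⟩ ⟨t, ht⟩⟩
  rw [integral_map measurable_subtype_coe.aemeasurable hU.aestronglyMeasurable,
    integral_map measurable_subtype_coe.aemeasurable hV.aestronglyMeasurable] at hUV
  simpa only [U, V, projIcc_val, integral_neg, sub_neg_eq_add] using hUV

lemma integrable_of_continuousOn_of_isCompact {X : Type*} [TopologicalSpace X] [T2Space X]
    [MeasurableSpace X] [OpensMeasurableSpace X] {μ : Measure X} [IsFiniteMeasureOnCompacts μ]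
    {s : Set X} {ψ : X → ℝ} (hs : IsCompact s) (hμ : μ sᶜ = 0) (hψ : ContinuousOn ψ s) :
    Integrable ψ μ := by
  have h := hψ.integrableOn_compact (μ := μ) hs
  rwa [IntegrableOn, Measure.restrict_eq_self_of_ae_mem (mem_ae_iff.2 hμ)] at h

end DualPotentials

section ReducedEnergy

variable {Ω : Set Plane} {u : Plane → ℝ} {φ : Plane × ℝ → ℝ} {f : ℝ → Plane → ℝ} {g : Plane → ℝ}

lemma graphMeasure_restrict (hΩ : IsOpen Ω) (hu : Measurable u)
    (hu₁ : ∀ x, u x ∈ Icc (0 : ℝ) 1) :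
    (graphMeasure Ω u).restrict (Ω ×ˢ Icc (0 : ℝ) 1) = graphMeasure Ω u := by
  refine Measure.restrict_eq_self_of_ae_mem ?_
  rw [graphMeasure, ae_map_iff (p := fun q => q ∈ Ω ×ˢ Icc (0 : ℝ) 1) (by fun_prop)
    (hΩ.measurableSet.prod measurableSet_Icc)]
  exact (ae_restrict_mem hΩ.measurableSet).mono fun x hx => ⟨hx, hu₁ x⟩

lemma histogram_eq_map (hΩ : IsOpen Ω) (hΩ_fin : volume Ω ≠ ⊤) (hu : Measurable u)
    (hu₁ : ∀ x, u x ∈ Icc (0 : ℝ) 1)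
    (hφ : φ =ᵐ[volume.restrict (Ω ×ˢ (univ : Set ℝ))] subgraphFn u) :
    histogram Ω φ = volume[|Ω].map u := by
  rw [histogram, negDerivGamma_eq hΩ hΩ_fin hu hφ, graphMeasure_restrict hΩ hu hu₁, graphMeasure,
    Measure.map_map measurable_snd (by fun_prop), ProbabilityTheory.cond, Measure.map_smul]
  rfl

lemma aemeasurable_graphMeasure (hΩ : IsOpen Ω) (hu : Measurable u)
    (hu₁ : ∀ x, u x ∈ Icc (0 : ℝ) 1)
    (hf : ContinuousOn (fun q : ℝ × Plane => f q.1 q.2) (Icc (0 : ℝ) 1 ×ˢ Ω)) :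
    AEMeasurable (fun p : Plane × ℝ => f p.2 p.1) (graphMeasure Ω u) := by
  rw [← graphMeasure_restrict hΩ hu hu₁]
  exact (hf.comp continuous_swap.continuousOn fun p hp => ⟨hp.2, hp.1⟩).aemeasurable
    (hΩ.measurableSet.prod measurableSet_Icc)

lemma aemeasurable_comp_graph (hΩ : IsOpen Ω) (hu : Measurable u)
    (hu₁ : ∀ x, u x ∈ Icc (0 : ℝ) 1)
    (hf : ContinuousOn (fun q : ℝ × Plane => f q.1 q.2) (Icc (0 : ℝ) 1 ×ˢ Ω)) :
    AEMeasurable (fun x => f (u x) x) (volume.restrict Ω) :=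
  (aemeasurable_graphMeasure hΩ hu hu₁ hf).comp_measurable (by fun_prop)

/-- The part of the energy of the subgraph of `u` that does not involve the dual potentials. The
lower bound `g` is subtracted from the data term, so that the values lie in `[0, ∞]`. -/
noncomputable def baseEnergy (Ω : Set Plane) (f : ℝ → Plane → ℝ) (g : Plane → ℝ) (lam : ℝ)
    (u : Plane → ℝ) : ENNReal :=
  (∫⁻ x in Ω, ENNReal.ofReal (f (u x) x - g x)) + ENNReal.ofReal lam * coareaIntegral Ω u

/-- The value `∫ ψ dμ - ∫ ψ' dμ₀` of the dual transport problem at the potentials `p = (ψ, ψ')`,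
where `μ` is the distribution of `u` under the normalised Lebesgue measure on `Ω`. -/
noncomputable def dualValue (Ω : Set Plane) (μ₀ : Measure ℝ) (p : (ℝ → ℝ) × (ℝ → ℝ))
    (u : Plane → ℝ) : ℝ :=
  ∫ x, p.1 (u x) ∂volume[|Ω] - ∫ t, p.2 t ∂μ₀

/-- The energy of the subgraph of `u`, with the supremum over the dual potentials restricted to
continuous ones. The function `g` is the lower bound of the data term; the energy does not depend
on its choice. -/
noncomputable def reducedEnergy (Ω : Set Plane) (f : ℝ → Plane → ℝ) (g : Plane → ℝ) (lam nu : ℝ)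
    (c : ℝ → ℝ → ℝ) (μ₀ : Measure ℝ) (u : Plane → ℝ) : EReal :=
  ⨆ p ∈ continuousDualSet c, (baseEnergy Ω f g lam u : EReal) +
    (((∫ x in Ω, g x) + nu * dualValue Ω μ₀ p u : ℝ) : EReal)

variable {lam nu : ℝ} {c : ℝ → ℝ → ℝ} {μ₀ : Measure ℝ}

lemma liftedEnergy_eq (hΩ : IsOpen Ω) (hΩ_fin : volume Ω ≠ ⊤) (hu : Measurable u)
    (hu₁ : ∀ x, u x ∈ Icc (0 : ℝ) 1)
    (hφ : φ =ᵐ[volume.restrict (Ω ×ˢ (univ : Set ℝ))] subgraphFn u)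
    (hf : ContinuousOn (fun q : ℝ × Plane => f q.1 q.2) (Icc (0 : ℝ) 1 ×ˢ Ω))
    (hg : IntegrableOn g Ω) (hgf : ∀ γ ∈ Icc (0 : ℝ) 1, ∀ x ∈ Ω, g x ≤ f γ x)
    (hlam : 0 ≤ lam) (nu : ℝ) (μ₀ : Measure ℝ) (ψ ψ' : ℝ → ℝ) :
    liftedEnergy Ω f lam nu μ₀ φ ψ ψ' =
      (baseEnergy Ω f g lam u : EReal) + ((∫ x in Ω, g x : ℝ) : EReal)
        + (nu : EReal) * (extIntegral (volume[|Ω].map u) ψ + extIntegral μ₀ fun t => -ψ' t) := by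
  have hdata : extIntegral (graphMeasure Ω u) (fun p => f p.2 p.1)
      = ((∫⁻ x in Ω, ENNReal.ofReal (f (u x) x - g x) : ENNReal) : EReal)
        + ((∫ x in Ω, g x : ℝ) : EReal) :=
    (extIntegral_map (by fun_prop) (aemeasurable_graphMeasure hΩ hu hu₁ hf)).trans <|
      extIntegral_eq_lintegral_sub_add (aemeasurable_comp_graph hΩ hu hu₁ hf) hg <|
        (ae_restrict_mem hΩ.measurableSet).mono fun x hx => hgf _ (hu₁ x) x hx
  rw [liftedEnergy, negDerivGamma_eq hΩ hΩ_fin hu hφ, graphMeasure_restrict hΩ hu hu₁,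
    histogram_eq_map hΩ hΩ_fin hu hu₁ hφ, lintegral_TV_congr_ae hφ, hdata, baseEnergy,
    EReal.coe_ennreal_add, EReal.coe_ennreal_mul, EReal.coe_ennreal_ofReal, max_eq_left hlam]
  exact congrArg (· + _) (add_right_comm _ _ _)

lemma map_compl_eq_zero {α β : Type*} [MeasurableSpace α] [MeasurableSpace β] {μ : Measure α}
    {F : α → β} {s : Set β} (hF : Measurable F) (hs : MeasurableSet s) (hFs : ∀ x, F x ∈ s) :
    μ.map F sᶜ = 0 := by
  rw [Measure.map_apply hF hs.compl, preimage_compl,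
    preimage_eq_univ_iff.2 (range_subset_iff.2 hFs), compl_univ, measure_empty]

lemma integral_sub_integral_eq_dualValue (hu : Measurable u) {p : (ℝ → ℝ) × (ℝ → ℝ)}
    (hp : p ∈ continuousDualSet c) :
    ∫ t, p.1 t ∂(volume[|Ω].map u) - ∫ t, p.2 t ∂μ₀ = dualValue Ω μ₀ p u := by
  rw [integral_map hu.aemeasurable hp.1.aestronglyMeasurable, dualValue]

lemma extIntegral_add_eq_dualValue [IsFiniteMeasure μ₀] (hu : Measurable u)
    (hu₁ : ∀ x, u x ∈ Icc (0 : ℝ) 1) (hμ₀ : μ₀ (Icc (0 : ℝ) 1)ᶜ = 0)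
    {p : (ℝ → ℝ) × (ℝ → ℝ)} (hp : p ∈ continuousDualSet c) :
    extIntegral (volume[|Ω].map u) p.1 + extIntegral μ₀ (fun t => -p.2 t)
      = (dualValue Ω μ₀ p u : EReal) := by
  have hψ : Integrable p.1 (volume[|Ω].map u) :=
    integrable_of_continuousOn_of_isCompact isCompact_Icc
      (map_compl_eq_zero hu measurableSet_Icc hu₁) hp.1.continuousOn
  have hψ' : Integrable (fun t => -p.2 t) μ₀ :=
    integrable_of_continuousOn_of_isCompact isCompact_Icc hμ₀ hp.2.1.neg.continuousOn
  rw [extIntegral_eq_integral hψ, extIntegral_eq_integral hψ', ← EReal.coe_add, integral_neg,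
    ← sub_eq_add_neg, integral_sub_integral_eq_dualValue hu hp]

lemma reducedEnergy_le_iSup_liftedEnergy [IsFiniteMeasure μ₀] (hΩ : IsOpen Ω)
    (hΩ_fin : volume Ω ≠ ⊤) (hu : Measurable u) (hu₁ : ∀ x, u x ∈ Icc (0 : ℝ) 1)
    (hφ : φ =ᵐ[volume.restrict (Ω ×ˢ (univ : Set ℝ))] subgraphFn u)
    (hf : ContinuousOn (fun q : ℝ × Plane => f q.1 q.2) (Icc (0 : ℝ) 1 ×ˢ Ω))
    (hg : IntegrableOn g Ω) (hgf : ∀ γ ∈ Icc (0 : ℝ) 1, ∀ x ∈ Ω, g x ≤ f γ x)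
    (hμ₀ : μ₀ (Icc (0 : ℝ) 1)ᶜ = 0) (hlam : 0 ≤ lam) :
    reducedEnergy Ω f g lam nu c μ₀ u
      ≤ ⨆ p ∈ dualSet c, liftedEnergy Ω f lam nu μ₀ φ p.1 p.2 := by
  refine iSup₂_le fun p hp => le_iSup₂_of_le p (continuousDualSet_subset_dualSet hp) (le_of_eq ?_)
  rw [liftedEnergy_eq hΩ hΩ_fin hu hu₁ hφ hf hg hgf hlam,
    extIntegral_add_eq_dualValue hu hu₁ hμ₀ hp, EReal.coe_add, EReal.coe_mul, add_assoc]

lemma dualValue_const [IsProbabilityMeasure μ₀] (hΩ₀ : volume Ω ≠ 0) (hΩ_fin : volume Ω ≠ ⊤)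
    (m : ℝ) (u : Plane → ℝ) : dualValue Ω μ₀ (fun _ => m, fun _ => 0) u = m := by
  have := cond_isProbabilityMeasure_of_finite hΩ₀ hΩ_fin
  simp [dualValue]

lemma baseEnergy_le_toENNReal_sub [IsProbabilityMeasure μ₀] (hΩ₀ : volume Ω ≠ 0)
    (hΩ_fin : volume Ω ≠ ⊤) {m : ℝ} (hm : (fun _ => m, fun _ => 0) ∈ continuousDualSet c) :
    baseEnergy Ω f g lam u
      ≤ (reducedEnergy Ω f g lam nu c μ₀ u - ((∫ x in Ω, g x) + nu * m : ℝ)).toENNReal := by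
  rw [← EReal.toENNReal_coe (x := baseEnergy Ω f g lam u)]
  refine EReal.toENNReal_le_toENNReal ((EReal.le_sub_iff_add_le (Or.inl (EReal.coe_ne_bot _))
    (Or.inl (EReal.coe_ne_top _))).2 ?_)
  refine le_iSup₂_of_le (fun _ => m, fun _ => 0) hm (le_of_eq ?_)
  rw [dualValue_const hΩ₀ hΩ_fin]

lemma sub_coe_ne_top {b : EReal} (hb : b ≠ ⊤) (r : ℝ) : b - r ≠ ⊤ := by
  rw [sub_eq_add_neg, ← EReal.coe_neg]
  exact EReal.add_ne_top hb (EReal.coe_ne_top _)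

lemma exists_coareaIntegral_le [IsProbabilityMeasure μ₀] (hΩ₀ : volume Ω ≠ 0)
    (hΩ_fin : volume Ω ≠ ⊤)
    (hc : LowerSemicontinuousOn (fun q : ℝ × ℝ => c q.1 q.2) (Icc (0 : ℝ) 1 ×ˢ Icc (0 : ℝ) 1))
    (hlam : 0 < lam) {b : EReal} (hb : b ≠ ⊤) :
    ∃ C : NNReal, ∀ u, reducedEnergy Ω f g lam nu c μ₀ u ≤ b → coareaIntegral Ω u ≤ C := by
  obtain ⟨m, hm⟩ := exists_const_mem_continuousDualSet hc
  let B : ENNReal := (b - ((∫ x in Ω, g x) + nu * m : ℝ)).toENNReal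
  have hB : B ≠ ⊤ := EReal.toENNReal_ne_top_iff.2 (sub_coe_ne_top hb _)
  have hlam' : ENNReal.ofReal lam ≠ 0 := (ENNReal.ofReal_pos.2 hlam).ne'
  refine ⟨(B / ENNReal.ofReal lam).toNNReal, fun u hu => ?_⟩
  rw [ENNReal.coe_toNNReal (ENNReal.div_ne_top hB hlam'),
    ENNReal.le_div_iff_mul_le (Or.inl hlam') (Or.inl ENNReal.ofReal_ne_top), mul_comm]
  calc ENNReal.ofReal lam * coareaIntegral Ω u ≤ baseEnergy Ω f g lam u := le_add_self
    _ ≤ _ := baseEnergy_le_toENNReal_sub hΩ₀ hΩ_fin hm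
    _ ≤ B := EReal.toENNReal_le_toENNReal (EReal.sub_le_sub hu le_rfl)

lemma baseEnergy_ne_top [IsProbabilityMeasure μ₀] (hΩ₀ : volume Ω ≠ 0) (hΩ_fin : volume Ω ≠ ⊤)
    (hc : LowerSemicontinuousOn (fun q : ℝ × ℝ => c q.1 q.2) (Icc (0 : ℝ) 1 ×ˢ Icc (0 : ℝ) 1))
    (h : reducedEnergy Ω f g lam nu c μ₀ u ≠ ⊤) : baseEnergy Ω f g lam u ≠ ⊤ := by
  obtain ⟨m, hm⟩ := exists_const_mem_continuousDualSet hc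
  exact ne_top_of_le_ne_top (EReal.toENNReal_ne_top_iff.2 (sub_coe_ne_top h _))
    (baseEnergy_le_toENNReal_sub hΩ₀ hΩ_fin hm)

lemma reducedEnergy_ne_bot
    (hc : LowerSemicontinuousOn (fun q : ℝ × ℝ => c q.1 q.2) (Icc (0 : ℝ) 1 ×ˢ Icc (0 : ℝ) 1)) :
    reducedEnergy Ω f g lam nu c μ₀ u ≠ ⊥ := by
  obtain ⟨m, hm⟩ := exists_const_mem_continuousDualSet hc
  exact ne_bot_of_le_ne_bot
    (EReal.add_ne_bot_iff.2 ⟨EReal.coe_ennreal_ne_bot _, EReal.coe_ne_bot _⟩)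
    (le_iSup₂_of_le (_, _) hm le_rfl)

lemma dualValue_le_of_reducedEnergy_le {A s : ℝ} (hA : (A : EReal) = baseEnergy Ω f g lam u)
    (hs : reducedEnergy Ω f g lam nu c μ₀ u ≤ s) (hnu : 0 < nu) {p : (ℝ → ℝ) × (ℝ → ℝ)}
    (hp : p ∈ continuousDualSet c) :
    dualValue Ω μ₀ p u ≤ (s - A - ∫ x in Ω, g x) / nu := by
  rw [reducedEnergy, ← hA] at hs
  have hle : A + ((∫ x in Ω, g x) + nu * dualValue Ω μ₀ p u) ≤ s := by
    exact_mod_cast (le_iSup₂_of_le p hp le_rfl).trans hs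
  rw [le_div_iff₀ hnu]
  linarith

lemma extIntegral_add_le_of_forall_dualValue_le [IsProbabilityMeasure μ₀] (hΩ₀ : volume Ω ≠ 0)
    (hΩ_fin : volume Ω ≠ ⊤) (hu : Measurable u) (hu₁ : ∀ x, u x ∈ Icc (0 : ℝ) 1)
    (hc : LowerSemicontinuousOn (fun q : ℝ × ℝ => c q.1 q.2) (Icc (0 : ℝ) 1 ×ˢ Icc (0 : ℝ) 1))
    (hμ₀ : μ₀ (Icc (0 : ℝ) 1)ᶜ = 0) {K : ℝ}
    (hK : ∀ q ∈ continuousDualSet c, dualValue Ω μ₀ q u ≤ K) {p : (ℝ → ℝ) × (ℝ → ℝ)}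
    (hp : p ∈ dualSet c) :
    extIntegral (volume[|Ω].map u) p.1 + extIntegral μ₀ (fun t => -p.2 t) ≤ K := by
  have := cond_isProbabilityMeasure_of_finite hΩ₀ hΩ_fin
  have := Measure.isProbabilityMeasure_map (μ := volume[|Ω]) hu.aemeasurable
  exact extIntegral_add_le_of_mem_dualSet hc
    (map_compl_eq_zero (μ := volume[|Ω]) hu measurableSet_Icc hu₁) hμ₀
    (fun q hq => (integral_sub_integral_eq_dualValue hu hq).trans_le (hK q hq)) hp

lemma iSup_liftedEnergy_le_reducedEnergy [IsProbabilityMeasure μ₀] (hΩ : IsOpen Ω)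
    (hΩ₀ : volume Ω ≠ 0) (hΩ_fin : volume Ω ≠ ⊤) (hu : Measurable u)
    (hu₁ : ∀ x, u x ∈ Icc (0 : ℝ) 1)
    (hφ : φ =ᵐ[volume.restrict (Ω ×ˢ (univ : Set ℝ))] subgraphFn u)
    (hf : ContinuousOn (fun q : ℝ × Plane => f q.1 q.2) (Icc (0 : ℝ) 1 ×ˢ Ω))
    (hg : IntegrableOn g Ω) (hgf : ∀ γ ∈ Icc (0 : ℝ) 1, ∀ x ∈ Ω, g x ≤ f γ x)
    (hc : LowerSemicontinuousOn (fun q : ℝ × ℝ => c q.1 q.2) (Icc (0 : ℝ) 1 ×ˢ Icc (0 : ℝ) 1))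
    (hμ₀ : μ₀ (Icc (0 : ℝ) 1)ᶜ = 0) (hlam : 0 ≤ lam) (hnu : 0 < nu) :
    ⨆ p ∈ dualSet c, liftedEnergy Ω f lam nu μ₀ φ p.1 p.2
      ≤ reducedEnergy Ω f g lam nu c μ₀ u := by
  rcases eq_or_ne (reducedEnergy Ω f g lam nu c μ₀ u) ⊤ with htop | htop
  · exact htop ▸ le_top
  have hA := EReal.coe_ennreal_toReal (baseEnergy_ne_top hΩ₀ hΩ_fin hc htop)
  have hbot := reducedEnergy_ne_bot (Ω := Ω) (f := f) (g := g) (lam := lam) (nu := nu) (u := u)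
    (μ₀ := μ₀) hc
  lift reducedEnergy Ω f g lam nu c μ₀ u to ℝ using ⟨htop, hbot⟩ with s hs
  set A : ℝ := (baseEnergy Ω f g lam u).toReal
  have hdual (p) (hp : p ∈ dualSet c) := extIntegral_add_le_of_forall_dualValue_le hΩ₀ hΩ_fin hu
    hu₁ hc hμ₀ (fun q hq => dualValue_le_of_reducedEnergy_le hA hs.ge hnu hq) hp
  refine iSup₂_le fun p hp => ?_
  calc liftedEnergy Ω f lam nu μ₀ φ p.1 p.2
      ≤ (A : EReal) + ((∫ x in Ω, g x : ℝ) : EReal)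
        + (nu : EReal) * (((s - A - ∫ x in Ω, g x) / nu : ℝ) : EReal) := by
        rw [liftedEnergy_eq hΩ hΩ_fin hu hu₁ hφ hf hg hgf hlam, ← hA]
        gcongr
        exact hdual p hp
    _ = s := by
        norm_cast
        rw [mul_div_cancel₀ _ hnu.ne']
        ring

end ReducedEnergy

section DirectMethod

variable {Ω : Set Plane} {f : ℝ → Plane → ℝ} {g : Plane → ℝ} {v : ℕ → Plane → ℝ} {w : Plane → ℝ}
  {lam nu : ℝ} {c : ℝ → ℝ → ℝ} {μ₀ : Measure ℝ}

lemma liminf_add_liminf_le {ι : Type*} (l : Filter ι) (a b : ι → ENNReal) :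
    liminf a l + liminf b l ≤ liminf (fun i => a i + b i) l := by
  rw [liminf_eq_iSup_iInf, liminf_eq_iSup_iInf (u := b)]
  exact ENNReal.biSup_add_biSup_le' ⟨_, univ_mem⟩ ⟨_, univ_mem⟩ fun s hs t ht =>
    le_liminf_of_le (h := mem_of_superset (inter_mem hs ht) fun i hi =>
      add_le_add (biInf_le a hi.1) (biInf_le b hi.2))

lemma lintegral_sub_le_liminf (hΩ : IsOpen Ω) (hv : ∀ n, Measurable (v n))
    (hv₁ : ∀ n x, v n x ∈ Icc (0 : ℝ) 1) (hw₁ : ∀ x, w x ∈ Icc (0 : ℝ) 1)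
    (hlim : ∀ᵐ x ∂volume.restrict Ω, Tendsto (fun n => v n x) atTop (𝓝 (w x)))
    (hf : ContinuousOn (fun q : ℝ × Plane => f q.1 q.2) (Icc (0 : ℝ) 1 ×ˢ Ω))
    (hg : IntegrableOn g Ω) :
    ∫⁻ x in Ω, ENNReal.ofReal (f (w x) x - g x) ≤
      liminf (fun n => ∫⁻ x in Ω, ENNReal.ofReal (f (v n x) x - g x)) atTop := by
  refine (lintegral_mono_ae ?_).trans (lintegral_liminf_le' fun n =>
    ((aemeasurable_comp_graph hΩ (hv n) (hv₁ n) hf).sub hg.aemeasurable).ennreal_ofReal)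
  filter_upwards [hlim, ae_restrict_mem hΩ.measurableSet] with x hx hxΩ
  have hgraph : Tendsto (fun n => (v n x, x)) atTop (𝓝[Icc (0 : ℝ) 1 ×ˢ Ω] (w x, x)) :=
    tendsto_nhdsWithin_iff.2 ⟨hx.prodMk_nhds tendsto_const_nhds,
      Eventually.of_forall fun n => ⟨hv₁ n x, hxΩ⟩⟩
  have hfx : Tendsto (fun n => f (v n x) x) atTop (𝓝 (f (w x) x)) :=
    (hf (w x, x) ⟨hw₁ x, hxΩ⟩).tendsto.comp hgraph
  exact (ENNReal.tendsto_ofReal (hfx.sub_const (g x))).liminf_eq.ge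

lemma baseEnergy_le_liminf (hΩ : IsOpen Ω) (hΩ_fin : volume Ω ≠ ⊤) (hv : ∀ n, Measurable (v n))
    (hv₁ : ∀ n x, v n x ∈ Icc (0 : ℝ) 1) (hw : Measurable w) (hw₁ : ∀ x, w x ∈ Icc (0 : ℝ) 1)
    (hlim : ∀ᵐ x ∂volume.restrict Ω, Tendsto (fun n => v n x) atTop (𝓝 (w x)))
    (hf : ContinuousOn (fun q : ℝ × Plane => f q.1 q.2) (Icc (0 : ℝ) 1 ×ˢ Ω))
    (hg : IntegrableOn g Ω) :
    baseEnergy Ω f g lam w ≤ liminf (fun n => baseEnergy Ω f g lam (v n)) atTop := by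
  calc baseEnergy Ω f g lam w
      ≤ liminf (fun n => ∫⁻ x in Ω, ENNReal.ofReal (f (v n x) x - g x)) atTop
        + ENNReal.ofReal lam * liminf (fun n => coareaIntegral Ω (v n)) atTop :=
        add_le_add (lintegral_sub_le_liminf hΩ hv hv₁ hw₁ hlim hf hg) <| by
          gcongr
          exact coareaIntegral_le_liminf hΩ_fin hv hw hlim
    _ ≤ liminf (fun n => baseEnergy Ω f g lam (v n)) atTop := by
        rw [← ENNReal.liminf_const_mul_of_ne_top ENNReal.ofReal_ne_top]
        exact liminf_add_liminf_le _ _ _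

lemma tendsto_dualValue (hv : ∀ n, Measurable (v n)) (hv₁ : ∀ n x, v n x ∈ Icc (0 : ℝ) 1)
    (hlim : ∀ᵐ x ∂volume.restrict Ω, Tendsto (fun n => v n x) atTop (𝓝 (w x)))
    {p : (ℝ → ℝ) × (ℝ → ℝ)} (hp : p ∈ continuousDualSet c) :
    Tendsto (fun n => dualValue Ω μ₀ p (v n)) atTop (𝓝 (dualValue Ω μ₀ p w)) := by
  obtain ⟨C, hC⟩ :=
    (isCompact_Icc (a := (0 : ℝ)) (b := 1)).exists_bound_of_continuousOn hp.1.continuousOn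
  refine Tendsto.sub_const (tendsto_integral_of_dominated_convergence (fun _ => C)
    (fun n => (hp.1.measurable.comp (hv n)).aestronglyMeasurable) (integrable_const C)
    (fun n => Eventually.of_forall fun x => hC _ (hv₁ n x)) ?_) _
  exact Measure.ae_smul_measure (hlim.mono fun x hx => (hp.1.tendsto _).comp hx) _

lemma reducedEnergy_le_liminf (hΩ : IsOpen Ω) (hΩ_fin : volume Ω ≠ ⊤)
    (hv : ∀ n, Measurable (v n)) (hv₁ : ∀ n x, v n x ∈ Icc (0 : ℝ) 1) (hw : Measurable w)
    (hw₁ : ∀ x, w x ∈ Icc (0 : ℝ) 1)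
    (hlim : ∀ᵐ x ∂volume.restrict Ω, Tendsto (fun n => v n x) atTop (𝓝 (w x)))
    (hf : ContinuousOn (fun q : ℝ × Plane => f q.1 q.2) (Icc (0 : ℝ) 1 ×ˢ Ω))
    (hg : IntegrableOn g Ω) :
    reducedEnergy Ω f g lam nu c μ₀ w
      ≤ liminf (fun n => reducedEnergy Ω f g lam nu c μ₀ (v n)) atTop := by
  refine iSup₂_le fun p hp => ?_
  have hbase : (baseEnergy Ω f g lam w : EReal)
      ≤ liminf (fun n => (baseEnergy Ω f g lam (v n) : EReal)) atTop := by
    refine (EReal.coe_ennreal_le_coe_ennreal_iff.2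
      (baseEnergy_le_liminf hΩ hΩ_fin hv hv₁ hw hw₁ hlim hf hg)).trans_eq ?_
    exact Monotone.map_liminf_of_continuousAt (f := ((↑) : ENNReal → EReal))
      (fun _ _ => EReal.coe_ennreal_le_coe_ennreal_iff.2) _
      continuous_coe_ennreal_ereal.continuousAt
  have hdual : Tendsto
      (fun n => (((∫ x in Ω, g x) + nu * dualValue Ω μ₀ p (v n) : ℝ) : EReal)) atTop
      (𝓝 (((∫ x in Ω, g x) + nu * dualValue Ω μ₀ p w : ℝ) : EReal)) :=
    EReal.tendsto_coe.2 (((tendsto_dualValue hv hv₁ hlim hp).const_mul nu).const_add _)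
  rw [← hdual.liminf_eq]
  exact (add_le_add_left hbase _).trans <| EReal.le_liminf_add.trans <|
    liminf_le_liminf <| Eventually.of_forall fun n => le_iSup₂_of_le p hp le_rfl

lemma exists_isMinOn_of_forall_seq {α β : Type*} [CompleteLinearOrder β] [TopologicalSpace β]
    [OrderTopology β] [FirstCountableTopology β] {S : Set α} (hS : S.Nonempty) {F : α → β}
    (hF : ∀ (u : ℕ → α) (a : β), (∀ n, u n ∈ S) → a ≠ ⊤ →
      Tendsto (fun n => F (u n)) atTop (𝓝 a) → ∃ v ∈ S, F v ≤ a) :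
    ∃ v ∈ S, IsMinOn F S v := by
  by_cases htop : sInf (F '' S) = ⊤
  · obtain ⟨v, hv⟩ := hS
    exact ⟨v, hv, fun w hw => le_top.trans (htop.ge.trans (sInf_le (mem_image_of_mem F hw)))⟩
  obtain ⟨s, -, hs_lim, hs⟩ := exists_seq_tendsto_sInf (hS.image F) (OrderBot.bddBelow _)
  choose u hu hus using hs
  obtain ⟨v, hv, hFv⟩ := hF u _ hu htop (by simpa only [hus] using hs_lim)
  exact ⟨v, hv, fun w hw => hFv.trans (sInf_le (mem_image_of_mem F hw))⟩

lemma exists_isMinOn_reducedEnergy [IsProbabilityMeasure μ₀] (hΩ : IsOpen Ω) (hΩ₀ : volume Ω ≠ 0)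
    (hΩ_fin : volume Ω ≠ ⊤)
    (hf : ContinuousOn (fun q : ℝ × Plane => f q.1 q.2) (Icc (0 : ℝ) 1 ×ˢ Ω))
    (hg : IntegrableOn g Ω)
    (hc : LowerSemicontinuousOn (fun q : ℝ × ℝ => c q.1 q.2) (Icc (0 : ℝ) 1 ×ˢ Icc (0 : ℝ) 1))
    (hlam : 0 < lam) :
    ∃ u ∈ {u : Plane → ℝ | Measurable u ∧ ∀ x, u x ∈ Icc (0 : ℝ) 1},
      IsMinOn (reducedEnergy Ω f g lam nu c μ₀)
        {u : Plane → ℝ | Measurable u ∧ ∀ x, u x ∈ Icc (0 : ℝ) 1} u := by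
  have hne : {u : Plane → ℝ | Measurable u ∧ ∀ x, u x ∈ Icc (0 : ℝ) 1}.Nonempty :=
    ⟨fun _ => 0, measurable_const, fun _ => unitInterval.zero_mem⟩
  refine exists_isMinOn_of_forall_seq hne fun v a hv ha hlim => ?_
  obtain ⟨b, hab, hb⟩ := exists_between (lt_top_iff_ne_top.2 ha)
  obtain ⟨C, hC⟩ := exists_coareaIntegral_le (f := f) (g := g) (nu := nu) (μ₀ := μ₀) hΩ₀ hΩ_fin hc
    hlam hb.ne
  obtain ⟨N, hN⟩ := eventually_atTop.1 (hlim.eventually_le_const hab)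
  obtain ⟨w, k, hk, hw, hw₁, hvw⟩ := exists_subseq_tendsto_ae_of_TV_le hΩ hΩ_fin
    (u := fun n => v (n + N)) (fun n => (hv _).1) (fun n => (hv _).2) fun n =>
      (TV_le_coareaIntegral (hv _).1 (hv _).2).trans (hC _ (hN _ (Nat.le_add_left N n)))
  exact ⟨w, ⟨hw, hw₁⟩, (reducedEnergy_le_liminf hΩ hΩ_fin (fun n => (hv _).1) (fun n => (hv _).2)
    hw hw₁ hvw hf hg).trans_eq
      (hlim.comp ((tendsto_add_atTop_nat N).comp hk.tendsto_atTop)).liminf_eq⟩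

end DirectMethod

section LiftedMinimizers

variable {Ω : Set Plane} {f : ℝ → Plane → ℝ} {g : Plane → ℝ} {u : Plane → ℝ} {lam nu : ℝ}
  {c : ℝ → ℝ → ℝ} {μ₀ : Measure ℝ}

lemma coareaIntegral_zero (Ω : Set Plane) : coareaIntegral Ω 0 = 0 := by
  rw [coareaIntegral, ← lintegral_zero (μ := volume.restrict (Icc (0 : ℝ) 1))]
  refine setLIntegral_congr_fun measurableSet_Icc fun γ hγ => ?_
  simp only [fun x : Plane => subgraphFn_of_le (u := (0 : Plane → ℝ)) (x := x) hγ.1, TV_const]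

lemma IsLifted.exists_reducedEnergy_le_iSup_liftedEnergy [IsFiniteMeasure μ₀] (hΩ : IsOpen Ω)
    (hΩ_fin : volume Ω ≠ ⊤)
    (hf : ContinuousOn (fun q : ℝ × Plane => f q.1 q.2) (Icc (0 : ℝ) 1 ×ˢ Ω))
    (hg : IntegrableOn g Ω) (hgf : ∀ γ ∈ Icc (0 : ℝ) 1, ∀ x ∈ Ω, g x ≤ f γ x)
    (hμ₀ : μ₀ (Icc (0 : ℝ) 1)ᶜ = 0) (hlam : 0 ≤ lam) {φ : Plane × ℝ → ℝ} (hφ : IsLifted Ω φ) :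
    ∃ u ∈ {u : Plane → ℝ | Measurable u ∧ ∀ x, u x ∈ Icc (0 : ℝ) 1},
      reducedEnergy Ω f g lam nu c μ₀ u
        ≤ ⨆ p ∈ dualSet c, liftedEnergy Ω f lam nu μ₀ φ p.1 p.2 := by
  obtain ⟨u, hu, hu₁, hφu⟩ := hφ.exists_ae_eq_subgraphFn hΩ
  exact ⟨u, ⟨hu, hu₁⟩, reducedEnergy_le_iSup_liftedEnergy hΩ hΩ_fin hu hu₁ hφu hf hg hgf hμ₀ hlam⟩

lemma exists_isLifted_iSup_liftedEnergy_le_reducedEnergy [IsProbabilityMeasure μ₀]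
    (hΩ : IsOpen Ω) (hΩ₀ : volume Ω ≠ 0) (hΩ_fin : volume Ω ≠ ⊤) (hu : Measurable u)
    (hu₁ : ∀ x, u x ∈ Icc (0 : ℝ) 1)
    (hf : ContinuousOn (fun q : ℝ × Plane => f q.1 q.2) (Icc (0 : ℝ) 1 ×ˢ Ω))
    (hg : IntegrableOn g Ω) (hgf : ∀ γ ∈ Icc (0 : ℝ) 1, ∀ x ∈ Ω, g x ≤ f γ x)
    (hc : LowerSemicontinuousOn (fun q : ℝ × ℝ => c q.1 q.2) (Icc (0 : ℝ) 1 ×ˢ Icc (0 : ℝ) 1))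
    (hμ₀ : μ₀ (Icc (0 : ℝ) 1)ᶜ = 0) (hlam : 0 < lam) (hnu : 0 < nu) :
    ∃ φ, IsLifted Ω φ ∧ ⨆ p ∈ dualSet c, liftedEnergy Ω f lam nu μ₀ φ p.1 p.2
      ≤ reducedEnergy Ω f g lam nu c μ₀ u := by
  by_cases htop : reducedEnergy Ω f g lam nu c μ₀ u = ⊤
  · refine ⟨subgraphFn 0, isLifted_subgraphFn hΩ hΩ_fin measurable_zero
      (fun _ => unitInterval.zero_mem) ?_, htop ▸ le_top⟩
    simp only [coareaIntegral_zero, ne_eq, ENNReal.zero_ne_top, not_false_eq_true]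
  · obtain ⟨C, hC⟩ := exists_coareaIntegral_le (μ₀ := μ₀) hΩ₀ hΩ_fin hc hlam htop
    exact ⟨subgraphFn u, isLifted_subgraphFn hΩ hΩ_fin hu hu₁
        (ne_top_of_le_ne_top ENNReal.coe_ne_top (hC u le_rfl)),
      iSup_liftedEnergy_le_reducedEnergy hΩ hΩ₀ hΩ_fin hu hu₁ ae_eq_rfl hf hg hgf hc hμ₀ hlam.le
        hnu⟩

end LiftedMinimizers

end LiftedWasserstein

open LiftedWasserstein

theorem mainTheorem1_general
    (Ω : Set Plane) (hΩ_open : IsOpen Ω) (hΩ_fin : volume Ω ≠ ⊤) (hΩ_ne : Ω.Nonempty)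
    (f : ℝ → Plane → ℝ)
    (hf : ContinuousOn (fun q : ℝ × Plane => f q.1 q.2) (Icc (0 : ℝ) 1 ×ˢ Ω))
    (hf_below : ∃ g : Plane → ℝ, IntegrableOn g Ω ∧ ∀ γ ∈ Icc (0 : ℝ) 1, ∀ x ∈ Ω, g x ≤ f γ x)
    (c : ℝ → ℝ → ℝ)
    (hc : LowerSemicontinuousOn (fun q : ℝ × ℝ => c q.1 q.2) (Icc (0 : ℝ) 1 ×ˢ Icc (0 : ℝ) 1))
    (μ₀ : Measure ℝ) [IsProbabilityMeasure μ₀] (hμ₀ : μ₀ (Icc (0 : ℝ) 1)ᶜ = 0)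
    (lam nu : ℝ) (hlam : 0 < lam) (hnu : 0 < nu) :
    ∃ φ : Plane × ℝ → ℝ, IsLifted Ω φ ∧
      IsMinOn (fun φ' => ⨆ p ∈ dualSet c, liftedEnergy Ω f lam nu μ₀ φ' p.1 p.2)
        {φ' | IsLifted Ω φ'} φ := by
  obtain ⟨g, hg, hgf⟩ := hf_below
  have hΩ₀ : volume Ω ≠ 0 := (hΩ_open.measure_pos volume hΩ_ne).ne'
  obtain ⟨u, ⟨hu, hu₁⟩, hmin⟩ := exists_isMinOn_reducedEnergy (nu := nu) (μ₀ := μ₀) hΩ_open hΩ₀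
    hΩ_fin hf hg hc hlam
  obtain ⟨φ, hφ, hφu⟩ := exists_isLifted_iSup_liftedEnergy_le_reducedEnergy hΩ_open hΩ₀ hΩ_fin hu
    hu₁ hf hg hgf hc hμ₀ hlam hnu
  refine ⟨φ, hφ, fun φ' hφ' => ?_⟩
  obtain ⟨u', hu', hφu'⟩ := hφ'.exists_reducedEnergy_le_iSup_liftedEnergy (c := c) (nu := nu)
    hΩ_open hΩ_fin hf hg hgf hμ₀ hlam.le
  exact hφu.trans ((hmin hu').trans hφu')

theorem mainTheorem1
    (Ω : Set LiftedWasserstein.Plane) (hΩ_open : IsOpen Ω) (hΩ_bdd : Bornology.IsBounded Ω)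
    (hΩ_ne : Ω.Nonempty)
    (f : ℝ → LiftedWasserstein.Plane → ℝ)
    (hf : ContinuousOn (fun q : ℝ × LiftedWasserstein.Plane => f q.1 q.2) (Icc (0 : ℝ) 1 ×ˢ Ω))
    (hf_below : ∃ g : LiftedWasserstein.Plane → ℝ, IntegrableOn g Ω ∧
      ∀ γ ∈ Icc (0 : ℝ) 1, ∀ x ∈ Ω, g x ≤ f γ x)
    (c : ℝ → ℝ → ℝ)
    (hc : LowerSemicontinuousOn (fun q : ℝ × ℝ => c q.1 q.2) (Icc (0 : ℝ) 1 ×ˢ Icc (0 : ℝ) 1))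
    (hc_below : ∃ a b : ℝ → ℝ,
      UpperSemicontinuousOn a (Icc 0 1) ∧ IntegrableOn a (Icc 0 1) ∧
      UpperSemicontinuousOn b (Icc 0 1) ∧ IntegrableOn b (Icc 0 1) ∧
      ∀ γ₁ ∈ Icc (0 : ℝ) 1, ∀ γ₂ ∈ Icc (0 : ℝ) 1, a γ₁ + b γ₂ ≤ c γ₁ γ₂)
    (μ₀ : Measure ℝ) [IsProbabilityMeasure μ₀] (hμ₀ : μ₀ (Icc (0 : ℝ) 1)ᶜ = 0)
    (lam nu : ℝ) (hlam : 0 < lam) (hnu : 0 < nu) :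
    ∃ φ : LiftedWasserstein.Plane × ℝ → ℝ, LiftedWasserstein.IsLifted Ω φ ∧
      IsMinOn
        (fun φ' => ⨆ p ∈ LiftedWasserstein.dualSet c,
          LiftedWasserstein.liftedEnergy Ω f lam nu μ₀ φ' p.1 p.2)
        {φ' | LiftedWasserstein.IsLifted Ω φ'} φ :=
  mainTheorem1_general Ω hΩ_open hΩ_bdd.measure_lt_top.ne hΩ_ne f hf hf_below c hc μ₀ hμ₀ lam
    nu hlam hnu
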